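/- Let $n\ge 1$, $s\in(0,1)$, $T>0$, and let $\Omega\subset\mathbb R^n$ be a nonempty bounded open set. Let $\mathbb H^s_0(\Omega)$ be the space of (classes of) measurable functions $u:\mathbb R^n\to\mathbb R$ with $u|_\Omega\in L^2(\Omega)$, $u=0$ a.e. in $\mathbb R^n\setminus\Omega$, and $(x,y)\mapsto (u(x)-u(y))|x-y|^{-(n+2s)/2}$ in $L^2\big((\mathbb R^n\times\mathbb R^n)\setminus((\mathbb R^n\setminus\Omega)\times(\mathbb R^n\setminus\Omega))\big)$, equipped with the scalar product $$\langle u,v\rangle_{\mathbb H^s_0}=\int_{\mathbb R^n\times\mathbb R^n}\frac{(u(x)-u(y))(v(x)-v(y))}{|x-y|^{n+2s}}\,dx\,dy$$ and the corresponding norm. Elements of $L^2(\Omega)$ are extended by zero to $\mathbb R^n$. A real number $\lambda$ is an eigenvalue, with eigenfunction $w\in\mathbb H^s_0(\Omega)\setminus\{0\}$, if $\langle w,v\rangle_{\mathbb H^s_0}=\lambda\,(w,v)_{L^2(\Omega)}$ for all $v\in\mathbb H^s_0(\Omega)$. Let $\varphi\in L^2(\Omega)$, $f\in C([0,T];L^2(\Omega))\cap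 C^1((0,T];L^2(\Omega))$ and $p\in C[0,T]$. A weak solution of the Cauchy–Dirichlet problem $$\partial_t u+(-\Delta)^s u=p(t)u+f\ \text{ in }\Omega\times(0,T),\qquad u(\cdot,0)=\varphi\ \text{ in }\Omega,\qquad u=0\ \text{ in }(\mathbb R^n\setminus\Omega)\times(0,T)$$ is a function $u\in C([0,T];L^2(\Omega))\cap C((0,T];\mathbb H^s_0(\Omega))\cap C^1((0,T];L^2(\Omega))$ such that $u(0)=\varphi$ and, for all $t\in(0,T)$ and all $v\in\mathbb H^s_0(\Omega)$, $$(\partial_t u(t),v)_{L^2(\Omega)}+\langle u(t),v\rangle_{\mathbb H^s_0}=(p(t)u(t),v)_{L^2(\Omega)}+(f(t),v)_{L^2(\Omega)}.$$ Then the eigenvalues can be listed as a sequence $\lambda_1\le\lambda_2\le\dots$, each repeated according to its multiplicity, with corresponding eigenfunctions $\phi_1,\phi_2,\dots$ orthonormal in $L^2(\Omega)$. For every such listing, put $\varphi_k=(\varphi,\phi_k)_{L^2(\Omega)}$ and $f_k(t)=(f(t),\phi_k)_{L^2(\Omega)}$. Then both series in $$u(\cdot,t)=\sum_{k=1}^{\infty}\varphi_k\,e^{-\lambda_k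 t+\int_0^t p(\tau)\,d\tau}\,\phi_k+\sum_{k=1}^{\infty}\Big(\int_0^t f_k(\tau)\,e^{-\lambda_k(t-\tau)+\int_\tau^t p(y)\,dy}\,d\tau\Big)\phi_k$$ converge in $L^2(\Omega)$ for every $t\in[0,T]$, and the function $u$ so defined is the unique weak solution of the problem; that is, it is a weak solution, and every weak solution coincides with it on $[0,T]$. -/

import Mathlib

open MeasureTheory Set Filter Topology

noncomputable section

namespace FracHeat

/-- The Euclidean space `ℝⁿ`. -/
abbrev Space (n : ℕ) : Type := EuclideanSpace ℝ (Fin n)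

/-- The real Hilbert space `L²(Ω)`. -/
abbrev L2 {n : ℕ} (Ω : Set (Space n)) : Type := Lp ℝ 2 (volume.restrict Ω)

/-- The extension by zero to `ℝⁿ` of an element of `L²(Ω)`. -/
def zeroExt {n : ℕ} (Ω : Set (Space n)) (u : L2 Ω) : Space n → ℝ :=
  Ω.indicator u

/-- The set `Q = (ℝⁿ × ℝⁿ) \ (Ωᶜ × Ωᶜ)`. -/
def crossSet {n : ℕ} (Ω : Set (Space n)) : Set (Space n × Space n) :=
  (Ωᶜ ×ˢ Ωᶜ)ᶜ

/-- The space `ℍˢ(Ω)`: measurable functions on `ℝⁿ` whose restriction to `Ω` is in `L²(Ω)` and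
such that `(x, y) ↦ (u x - u y) / |x - y| ^ ((n + 2 s) / 2)` is in `L²(Q)`. -/
structure MemHs {n : ℕ} (s : ℝ) (Ω : Set (Space n)) (u : Space n → ℝ) : Prop where
  aemeasurable : AEMeasurable u volume
  memLp : MemLp u 2 (volume.restrict Ω)
  memLp_quotient :
    MemLp (fun z : Space n × Space n =>
      (u z.1 - u z.2) / ‖z.1 - z.2‖ ^ (((n : ℝ) + 2 * s) / 2)) 2
      (volume.restrict (crossSet Ω))

/-- The space `ℍ₀ˢ(Ω)`: elements of `ℍˢ(Ω)` that vanish a.e. outside `Ω`. -/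
structure MemH0s {n : ℕ} (s : ℝ) (Ω : Set (Space n)) (u : Space n → ℝ) : Prop where
  memHs : MemHs s Ω u
  ae_eq_zero : ∀ᵐ x ∂(volume.restrict Ωᶜ), u x = 0

/-- The scalar product of `ℍ₀ˢ(Ω)`:
`∫∫ (u x - u y) (v x - v y) / |x - y| ^ (n + 2 s) dx dy` over `ℝⁿ × ℝⁿ`. -/
def innerH0s {n : ℕ} (s : ℝ) (u v : Space n → ℝ) : ℝ :=
  ∫ z : Space n × Space n,
    (u z.1 - u z.2) * (v z.1 - v z.2) / ‖z.1 - z.2‖ ^ ((n : ℝ) + 2 * s)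

/-- The norm of `ℍ₀ˢ(Ω)`. -/
def normH0s {n : ℕ} (s : ℝ) (u : Space n → ℝ) : ℝ :=
  Real.sqrt (innerH0s s u u)

/-- `w` is an eigenfunction for the eigenvalue `μ` of the weak formulation of the Dirichlet problem
`(-Δ)ˢ w = μ w` in `Ω`, `w = 0` outside `Ω`. -/
structure IsEigenpair {n : ℕ} (s : ℝ) (Ω : Set (Space n)) (μ : ℝ) (w : L2 Ω) : Prop where
  ne_zero : w ≠ 0
  memH0s : MemH0s s Ω (zeroExt Ω w)
  weak_eq : ∀ v : Space n → ℝ, MemH0s s Ω v →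
    innerH0s s (zeroExt Ω w) v = μ * ∫ x in Ω, w x * v x

/-- `lam 0 ≤ lam 1 ≤ …` lists all the eigenvalues, each repeated according to its multiplicity, and
`e 0, e 1, …` are corresponding eigenfunctions, orthonormal in `L²(Ω)`. (Completeness of `e`
in `L²(Ω)` is not part of the definition.) -/
structure IsEigensystem {n : ℕ} (s : ℝ) (Ω : Set (Space n)) (lam : ℕ → ℝ) (e : ℕ → L2 Ω) :
    Prop where
  eigenpair : ∀ k, IsEigenpair s Ω (lam k) (e k)
  orthonormal : Orthonormal ℝ e
  monotone : Monotone lam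
  exhausts : ∀ (μ : ℝ) (w : L2 Ω), IsEigenpair s Ω μ w →
    w ∈ Submodule.span ℝ (e '' {k | lam k = μ})

/-- `u ∈ C((0,T]; ℍ₀ˢ(Ω))`. -/
structure ContinuousInH0s {n : ℕ} (s : ℝ) (Ω : Set (Space n)) (T : ℝ) (u : ℝ → L2 Ω) :
    Prop where
  memH0s : ∀ t ∈ Ioc (0 : ℝ) T, MemH0s s Ω (zeroExt Ω (u t))
  tendsto : ∀ t ∈ Ioc (0 : ℝ) T,
    Tendsto (fun τ => normH0s s (zeroExt Ω (u τ) - zeroExt Ω (u t))) (𝓝[Ioc 0 T] t) (𝓝 0)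

/-- `u ∈ C([0,T]; L²(Ω)) ∩ C((0,T]; ℍ₀ˢ(Ω)) ∩ C¹((0,T]; L²(Ω))` is a weak solution of
`∂ₜu + (-Δ)ˢ u = p u + f` in `Ω × (0,T)`, `u(0) = φ` in `Ω`, `u = 0` outside `Ω`. -/
structure IsWeakSolution {n : ℕ} (s : ℝ) (Ω : Set (Space n)) (T : ℝ) (p : ℝ → ℝ)
    (f : ℝ → L2 Ω) (φ : L2 Ω) (u : ℝ → L2 Ω) : Prop where
  continuousOn : ContinuousOn u (Icc 0 T)
  continuousInH0s : ContinuousInH0s s Ω T u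
  contDiffOn : ContDiffOn ℝ 1 u (Ioc 0 T)
  weak_eq : ∀ t ∈ Ioo (0 : ℝ) T, ∀ v : Space n → ℝ, MemH0s s Ω v →
    (∫ x in Ω, (deriv u t) x * v x) + innerH0s s (zeroExt Ω (u t)) v
      = (∫ x in Ω, p t * (u t) x * v x) + ∫ x in Ω, (f t) x * v x
  initial : u 0 = φ

/-- The coefficient `φₖ exp (-λₖ t + ∫₀ᵗ p)`, where `φₖ = (φ, eₖ)`. -/
def homCoeff {n : ℕ} {Ω : Set (Space n)} (lam : ℕ → ℝ) (e : ℕ → L2 Ω) (p : ℝ → ℝ) (φ : L2 Ω)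
    (k : ℕ) (t : ℝ) : ℝ :=
  inner ℝ φ (e k) * Real.exp (-lam k * t + ∫ τ in (0 : ℝ)..t, p τ)

/-- The coefficient `∫₀ᵗ fₖ(τ) exp (-λₖ (t - τ) + ∫_τ^t p) dτ`, where `fₖ(τ) = (f(τ), eₖ)`. -/
def sourceCoeff {n : ℕ} {Ω : Set (Space n)} (lam : ℕ → ℝ) (e : ℕ → L2 Ω) (p : ℝ → ℝ)
    (f : ℝ → L2 Ω) (k : ℕ) (t : ℝ) : ℝ :=
  ∫ τ in (0 : ℝ)..t, inner ℝ (f τ) (e k) * Real.exp (-lam k * (t - τ) + ∫ y in τ..t, p y)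

/-- The eigenfunction series of the solution. -/
def seriesSolution {n : ℕ} {Ω : Set (Space n)} (lam : ℕ → ℝ) (e : ℕ → L2 Ω) (p : ℝ → ℝ)
    (f : ℝ → L2 Ω) (φ : L2 Ω) (t : ℝ) : L2 Ω :=
  (∑' k, homCoeff lam e p φ k t • e k) + ∑' k, sourceCoeff lam e p f k t • e k

end FracHeat

end

/-! Write A for the Dirichlet fractional Laplacian. The form domain ℍ₀ˢ(Ω), normed by the L² product
plus the form, is realised as the closed graph `formGraph` of u ↦ `diffQuot s u`, hence is a Hilbert
space. Its embedding J into L²(Ω) is compact, since averaging over small cubes approximates u in L²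
with error controlled by the seminorm (`isCompactOperator_formProj`), and has dense range, since
test functions have finite seminorm (`eq_zero_of_forall_inner_formProj`). Then J J* is the resolvent
(1 + A)⁻¹: compact, symmetric and positive definite.

An eigenpair (μ, w) of A is an eigenpair (1/(1+μ), w) of the resolvent. Choosing maximisers of the
Rayleigh quotient one after another gives a monotone listing (`exists_orthonormal_eigenvectors`),
and the spectral theorem makes every exhaustive listing a Hilbert basis
(`IsEigensystem.exists_hilbertBasis`).

In such a basis the problem splits into scalar linear equations. This gives uniqueness at once. For
existence put u = e^P V with P = ∫p, which removes the potential: V' + AV = g, where g = e^{-P} f.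
The delicate point is that V is differentiable in L² (`exists_classical_solution`). Since g is C¹
only for positive times, one restarts at a > 0 and solves the equation satisfied by V' itself, with
source g' and initial value g(a) - AV(a); the semigroup smooths the possibly singular term AV(a)
after time a. Finally AV = g - V' is continuous in L², and the squared ℍ₀ˢ norm of V is (AV, V), so
V is continuous into ℍ₀ˢ(Ω). -/

noncomputable section

namespace FracHeat

/-! ### Spectral theory of compact symmetric positive definite operators. -/

section Spectral

open scoped InnerProductSpace

variable {H : Type*} [NormedAddCommGroup H] [InnerProductSpace ℝ H]

/-- The eigenvalues of a compact operator along an orthonormal sequence of eigenvectors are not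
bounded below by a positive constant. -/
theorem not_forall_le_eigenvalue {T : H →L[ℝ] H} (hc : IsCompactOperator T) {e : ℕ → H}
    (he : Orthonormal ℝ e) {κ : ℕ → ℝ} (hT : ∀ k, T (e k) = κ k • e k) {c : ℝ} (hcpos : 0 < c) :
    ¬ ∀ k, c ≤ κ k := by
  intro hle
  -- The vectors κ_k e_k lie in a compact set, yet by Pythagoras any two of them are at distance at
  -- least c, so no subsequence is Cauchy.
  have hcomp := hc.isCompact_closure_image_closedBall (f := T.toLinearMap) 1
  have hmem : ∀ k, T (e k) ∈ closure (T '' Metric.closedBall 0 1) := fun k =>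
    subset_closure ⟨e k, by simp [he.1 k], rfl⟩
  obtain ⟨a, -, ψ, hψ, hlim⟩ := hcomp.tendsto_subseq hmem
  have hcau := hlim.cauchySeq
  rw [Metric.cauchySeq_iff'] at hcau
  obtain ⟨N, hN⟩ := hcau c hcpos
  have hd := hN (N + 1) (Nat.le_succ N)
  have hneq : ψ (N + 1) ≠ ψ N := (hψ (Nat.lt_succ_self N)).ne'
  simp only [Function.comp_apply, hT, dist_eq_norm] at hd
  have horth : ⟪κ (ψ (N + 1)) • e (ψ (N + 1)), κ (ψ N) • e (ψ N)⟫_ℝ = 0 := by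
    rw [inner_smul_left, inner_smul_right, he.2 hneq]; simp
  have h2 : ‖κ (ψ (N + 1)) • e (ψ (N + 1)) - κ (ψ N) • e (ψ N)‖ ^ 2
      = κ (ψ (N + 1)) ^ 2 + κ (ψ N) ^ 2 := by
    rw [norm_sub_sq_real, horth, norm_smul, norm_smul, he.1, he.1]
    simp
  have h3 := hle (ψ (N + 1))
  have h4 : ‖κ (ψ (N + 1)) • e (ψ (N + 1)) - κ (ψ N) • e (ψ N)‖ ^ 2 < c ^ 2 := by
    gcongr
  nlinarith [sq_nonneg (κ (ψ N))]

variable [CompleteSpace H]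

/-- A compact symmetric positive definite operator on a nontrivial Hilbert space attains its maximal
Rayleigh quotient at an eigenvector. -/
theorem exists_eigenvector_isMax [Nontrivial H] {S : H →L[ℝ] H} (hc : IsCompactOperator S)
    (hs : S.toLinearMap.IsSymmetric) (hpos : ∀ x, x ≠ 0 → 0 < ⟪S x, x⟫_ℝ) :
    ∃ (e : H) (κ : ℝ), ‖e‖ = 1 ∧ 0 < κ ∧ S e = κ • e ∧ ∀ x, ⟪S x, x⟫_ℝ ≤ κ * ‖x‖ ^ 2 := by
  obtain ⟨x0, hx0⟩ := exists_ne (0 : H)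
  have hS0 : ‖S‖ ≠ 0 := fun h => by
    rw [norm_eq_zero] at h
    have := hpos x0 hx0
    simp [h] at this
  -- Self-adjointness puts ‖S‖ or -‖S‖ in the spectrum, compactness makes it an eigenvalue, and
  -- positivity selects ‖S‖. The Rayleigh bound is then Cauchy–Schwarz.
  have hrad := S.spectralRadius_eq_nnnorm hs.isSelfAdjoint
  have hne : (spectrum ℝ S).Nonempty := by
    by_contra h
    rw [Set.not_nonempty_iff_eq_empty] at h
    rw [spectralRadius, h] at hrad
    refine hS0 ?_
    have := congrArg ENNReal.toReal hrad
    simpa using this.symm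
  obtain ⟨μ, hμ, hμr⟩ := spectrum.exists_nnnorm_eq_spectralRadius_of_nonempty hne
  rw [hrad] at hμr
  have hμn : |μ| = ‖S‖ := by
    have := congrArg ENNReal.toReal hμr
    simpa using this
  have hμ0 : μ ≠ 0 := fun h => hS0 (by rw [← hμn, h, abs_zero])
  obtain ⟨w, hw⟩ := ((hc.hasEigenvalue_iff_mem_spectrum hμ0).2 hμ).exists_hasEigenvector
  have hSw : S w = μ • w := hw.apply_eq_smul
  have hw0 : w ≠ 0 := hw.2
  have hμpos : 0 < μ := by
    have h := hpos w hw0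
    rw [hSw, inner_smul_left, real_inner_self_eq_norm_sq] at h
    exact pos_of_mul_pos_left (by simpa using h) (by positivity)
  rw [abs_of_pos hμpos] at hμn
  have hw1 : ‖w‖ ≠ 0 := by simpa using hw0
  refine ⟨‖w‖⁻¹ • w, μ, ?_, hμpos, ?_, fun x => ?_⟩
  · rw [norm_smul]
    simp [hw1]
  · rw [map_smul, hSw, smul_comm]
  · rw [hμn]
    refine (real_inner_le_norm _ _).trans ?_
    have := S.le_opNorm x
    nlinarith [norm_nonneg x]

/-- A compact symmetric positive definite operator attains its maximal Rayleigh quotient on every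
nonzero closed invariant subspace, at an eigenvector. -/
theorem exists_eigenvector_isMaxOn {T : H →L[ℝ] H} (hc : IsCompactOperator T)
    (hs : T.toLinearMap.IsSymmetric) (hpos : ∀ x, x ≠ 0 → 0 < ⟪T x, x⟫_ℝ) (K : Submodule ℝ H)
    (hcl : IsClosed (K : Set H)) (hK : ∀ x ∈ K, T x ∈ K) (hne : K ≠ ⊥) :
    ∃ e ∈ K, ∃ κ : ℝ, ‖e‖ = 1 ∧ 0 < κ ∧ T e = κ • e ∧ ∀ x ∈ K, ⟪T x, x⟫_ℝ ≤ κ * ‖x‖ ^ 2 := by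
  have : CompleteSpace K := hcl.completeSpace_coe
  have : Nontrivial K := (Submodule.nontrivial_iff_ne_bot).2 hne
  obtain ⟨e, κ, h1, h2, h3, h4⟩ := exists_eigenvector_isMax (S := T.restrict hK)
    (hc.restrict' (V := K) hK) (hs.restrict_invariant hK)
    (fun x hx => hpos x (by simpa using hx))
  exact ⟨e, e.2, κ, h1, h2, congrArg Subtype.val h3, fun x hx => h4 ⟨x, hx⟩⟩

/-- A compact symmetric positive definite operator on an infinite dimensional Hilbert space has an
orthonormal sequence of eigenvectors, with decreasing eigenvalues, exhausting all eigenspaces. -/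
theorem exists_orthonormal_eigenvectors {T : H →L[ℝ] H} (hc : IsCompactOperator T)
    (hs : T.toLinearMap.IsSymmetric) (hpos : ∀ x, x ≠ 0 → 0 < ⟪T x, x⟫_ℝ)
    (hinf : ¬ FiniteDimensional ℝ H) :
    ∃ (κ : ℕ → ℝ) (e : ℕ → H), Orthonormal ℝ e ∧ (∀ k, 0 < κ k) ∧ (∀ k, T (e k) = κ k • e k) ∧
      Antitone κ ∧ ∀ (c : ℝ) (w : H), 0 < c → T w = c • w →
        w ∈ Submodule.span ℝ (e '' {k | κ k = c}) := by
  -- One stage of the greedy construction: by symmetry the orthogonal complement of an invariant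
  -- subspace is invariant, and it is nonzero because H is infinite dimensional.
  have key : ∀ V : Submodule ℝ H, (FiniteDimensional ℝ V ∧ ∀ x ∈ V, T x ∈ V) →
      ∃ (e : H) (κ : ℝ), e ∈ Vᗮ ∧ ‖e‖ = 1 ∧ 0 < κ ∧ T e = κ • e ∧
        ∀ x ∈ Vᗮ, ⟪T x, x⟫_ℝ ≤ κ * ‖x‖ ^ 2 := by
    rintro V ⟨hV, hinv⟩
    have hinv' : ∀ x ∈ Vᗮ, T x ∈ Vᗮ := fun x hx => by
      rw [Submodule.mem_orthogonal] at hx ⊢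
      intro u hu
      have := hs u x
      simp only [ContinuousLinearMap.coe_coe] at this
      rw [← this]
      exact hx _ (hinv u hu)
    have hne : Vᗮ ≠ ⊥ := fun h => by
      rw [Submodule.orthogonal_eq_bot_iff] at h
      subst h
      exact hinf (LinearEquiv.finiteDimensional Submodule.topEquiv)
    obtain ⟨e, he, κ, h⟩ := exists_eigenvector_isMaxOn hc hs hpos Vᗮ
      (Submodule.isClosed_orthogonal V) hinv' hne
    exact ⟨e, κ, he, h⟩
  -- Values of `ev` and `ei` are meaningful only on finite dimensional invariant subspaces, so every
  -- later use passes `hV k`.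
  choose! ev ei h1 h2 h3 h4 h5 using key
  obtain ⟨V, hV0, hVs⟩ : ∃ V : ℕ → Submodule ℝ H, V 0 = ⊥ ∧
      ∀ k, V (k + 1) = V k ⊔ Submodule.span ℝ {ev (V k)} :=
    ⟨fun k => Nat.rec ⊥ (fun _ W => W ⊔ Submodule.span ℝ {ev W}) k, rfl, fun _ => rfl⟩
  have hV : ∀ k : ℕ, FiniteDimensional ℝ (V k) ∧ ∀ x ∈ V k, T x ∈ V k := by
    intro k
    induction k with
    | zero =>
      rw [hV0]
      exact ⟨inferInstance, fun x hx => by simp [(Submodule.mem_bot ℝ).1 hx]⟩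
    | succ k ih =>
      rw [hVs]
      have := ih.1
      refine ⟨inferInstance, fun x hx => ?_⟩
      obtain ⟨y, hy, z, hz, rfl⟩ := Submodule.mem_sup.1 hx
      obtain ⟨a, rfl⟩ := Submodule.mem_span_singleton.1 hz
      rw [map_add, map_smul, h4 _ ih, smul_smul]
      exact Submodule.add_mem_sup (ih.2 y hy)
        (Submodule.smul_mem _ _ (Submodule.mem_span_singleton_self _))
  have hmono : Monotone V := monotone_nat_of_le_succ fun k => by rw [hVs]; exact le_sup_left
  have hmem : ∀ {m k}, m < k → ev (V m) ∈ V k := fun {m k} hmk => hmono hmk (by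
    rw [hVs]
    exact Submodule.mem_sup_right (Submodule.mem_span_singleton_self _))
  have hspan : ∀ k, V k ≤ Submodule.span ℝ (Set.range fun m => ev (V m)) := by
    intro k
    induction k with
    | zero => rw [hV0]; exact bot_le
    | succ k ih =>
      rw [hVs]
      exact sup_le ih (Submodule.span_mono (by rintro _ rfl; exact ⟨k, rfl⟩))
  have horth : Orthonormal ℝ fun k => ev (V k) := by
    refine ⟨fun k => h2 _ (hV k), fun i j hij => ?_⟩
    rcases lt_or_gt_of_ne hij with h | h
    · exact (Submodule.mem_orthogonal _ _).1 (h1 _ (hV j)) _ (hmem h)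
    · rw [real_inner_comm]
      exact (Submodule.mem_orthogonal _ _).1 (h1 _ (hV i)) _ (hmem h)
  refine ⟨fun k => ei (V k), fun k => ev (V k), horth, fun k => h3 _ (hV k), fun k => h4 _ (hV k),
    ?_, ?_⟩
  · refine antitone_nat_of_succ_le fun k => ?_
    -- The next eigenvector was already a competitor at stage k, because the complements decrease.
    have := h5 _ (hV k) (ev (V (k + 1)))
      (Submodule.orthogonal_le (hmono (Nat.le_succ k)) (h1 _ (hV (k + 1))))
    rw [h4 _ (hV (k + 1)), inner_smul_left, real_inner_self_eq_norm_sq, h2 _ (hV (k + 1))] at this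
    simpa using this
  · intro c w hcpos hw
    set S := Submodule.span ℝ ((fun k => ev (V k)) '' {k | ei (V k) = c}) with hS
    -- The span is finite dimensional, being inside an eigenspace of a compact operator for c ≠ 0.
    -- So w splits orthogonally along it, and the remainder z again satisfies T z = c z.
    have hSle : S ≤ Module.End.eigenspace T.toLinearMap c := by
      rw [hS, Submodule.span_le]
      rintro _ ⟨k, hk, rfl⟩
      rw [SetLike.mem_coe, Module.End.mem_eigenspace_iff]
      change T (ev (V k)) = c • ev (V k)
      rw [h4 _ (hV k)]
      have : ei (V k) = c := hk
      rw [this]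
    have : FiniteDimensional ℝ (Module.End.eigenspace T.toLinearMap c) :=
      T.finite_dimensional_eigenspace hc c hcpos.ne'
    have hfin : FiniteDimensional ℝ S := Submodule.finiteDimensional_of_le hSle
    obtain ⟨y, hy, z, hz, hyz⟩ := Submodule.exists_add_mem_mem_orthogonal (K := S) w
    have hTy : T y = c • y := Module.End.mem_eigenspace_iff.1 (hSle hy)
    have hTz : T z = c • z := by
      have : z = w - y := by rw [hyz]; abel
      rw [this, map_sub, hw, hTy, smul_sub]
    suffices z = 0 by rw [hyz, this, add_zero]; exact hy
    by_contra hz0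
    have hperp : ∀ k, ⟪ev (V k), z⟫_ℝ = 0 := by
      intro k
      by_cases hk : ei (V k) = c
      · exact (Submodule.mem_orthogonal _ _).1 hz _ (Submodule.subset_span ⟨k, hk, rfl⟩)
      · have := hs (ev (V k)) z
        simp only [ContinuousLinearMap.coe_coe, hTz, h4 _ (hV k), inner_smul_left,
          inner_smul_right] at this
        simp only [conj_trivial, mul_eq_mul_right_iff] at this
        exact this.resolve_left hk
    -- A nonzero z orthogonal to every chosen eigenvector competes at every stage with Rayleigh
    -- quotient c, forcing c ≤ κ_k for all k.
    refine not_forall_le_eigenvalue hc horth (fun k => h4 _ (hV k)) hcpos fun k => ?_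
    have hzV : z ∈ (V k)ᗮ := by
      refine Submodule.orthogonal_le (hspan k) ?_
      rw [Submodule.mem_orthogonal]
      intro u hu
      induction hu using Submodule.span_induction with
      | mem x hx => obtain ⟨m, rfl⟩ := hx; exact hperp m
      | zero => simp
      | add x y _ _ hx hy => rw [inner_add_left, hx, hy, add_zero]
      | smul a x _ hx => rw [inner_smul_left, hx, mul_zero]
    have := h5 _ (hV k) z hzV
    rw [hTz, inner_smul_left, real_inner_self_eq_norm_sq] at this
    have hz2 : 0 < ‖z‖ ^ 2 := by positivity
    exact le_of_mul_le_mul_right (by simpa using this) hz2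

/-- A family whose span contains every eigenvector of a compact symmetric positive definite operator
is total. -/
theorem orthogonal_span_eq_bot {T : H →L[ℝ] H} (hc : IsCompactOperator T)
    (hs : T.toLinearMap.IsSymmetric) (hpos : ∀ x, x ≠ 0 → 0 < ⟪T x, x⟫_ℝ) {A : Set H}
    (hA : ∀ (c : ℝ) (w : H), 0 < c → w ≠ 0 → T w = c • w → w ∈ Submodule.span ℝ A) :
    (Submodule.span ℝ A)ᗮ = ⊥ := by
  rw [eq_bot_iff, ← T.orthogonalComplement_iSup_eigenspaces_eq_bot hc hs]
  refine Submodule.orthogonal_le (iSup_le fun c w hw => ?_)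
  have hTw : T w = c • w := Module.End.mem_eigenspace_iff.1 hw
  by_cases hw0 : w = 0
  · rw [hw0]; exact zero_mem _
  · have h := hpos w hw0
    rw [hTw, inner_smul_left, real_inner_self_eq_norm_sq] at h
    exact hA c w (pos_of_mul_pos_left (by simpa using h) (by positivity)) hw0 hTw

end Spectral

/-! ### The diagonal parabolic equation in a Hilbert basis. -/

section Evolution

open scoped InnerProductSpace

/-- A continuous function on a compact interval extends to a continuous function on the line. -/
theorem exists_continuous_eqOn_Icc {E : Type*} [TopologicalSpace E] {f : ℝ → E} {a b : ℝ}
    (hab : a ≤ b) (hf : ContinuousOn f (Icc a b)) : ∃ F : ℝ → E, Continuous F ∧ EqOn F f (Icc a b) :=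
  ⟨IccExtend hab ((Icc a b).domRestrict f), (continuousOn_iff_continuous_domRestrict.1 hf).Icc_extend',
    fun x hx => by rw [IccExtend_of_mem hab _ hx]; rfl⟩

/-- The variation of constants formula. -/
theorem hasDerivAt_duhamel (l c a : ℝ) {γ : ℝ → ℝ} (hγ : Continuous γ) (t : ℝ) :
    HasDerivAt (fun t => Real.exp (-l * (t - a)) * c
        + ∫ τ in a..t, Real.exp (-l * (t - τ)) * γ τ)
      (γ t - l * (Real.exp (-l * (t - a)) * c + ∫ τ in a..t, Real.exp (-l * (t - τ)) * γ τ)) t := by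
  have h1 : ∀ t, ∫ τ in a..t, Real.exp (-l * (t - τ)) * γ τ
      = Real.exp (-l * t) * ∫ τ in a..t, Real.exp (l * τ) * γ τ := fun t => by
    rw [← intervalIntegral.integral_const_mul]
    congr 1
    funext τ
    rw [← mul_assoc, ← Real.exp_add]
    congr 2
    ring
  simp_rw [h1]
  have h2 : HasDerivAt (fun t => ∫ τ in a..t, Real.exp (l * τ) * γ τ) (Real.exp (l * t) * γ t) t :=
    (Continuous.integral_hasStrictDerivAt (by fun_prop) a t).hasDerivAt
  have h3 : HasDerivAt (fun t => Real.exp (-l * t)) (Real.exp (-l * t) * -l) t := by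
    simpa using ((hasDerivAt_id t).const_mul (-l)).exp
  have h4 : HasDerivAt (fun t => Real.exp (-l * (t - a))) (Real.exp (-l * (t - a)) * -l) t := by
    simpa using (((hasDerivAt_id t).sub_const a).const_mul (-l)).exp
  refine ((h4.mul_const c).add (h3.mul h2)).congr_deriv ?_
  have h5 : Real.exp (-l * t) * Real.exp (l * t) = 1 := by
    rw [← Real.exp_add]; simp
  linear_combination γ t * h5

/-- Solutions of a scalar homogeneous linear equation vanish if they vanish initially. -/
theorem eqOn_zero_of_hasDerivAt_mul {q d : ℝ → ℝ} {a b : ℝ} (hq : Continuous q)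
    (hd : ContinuousOn d (Icc a b)) (hd' : ∀ t ∈ Ioo a b, HasDerivAt d (q t * d t) t)
    (ha : d a = 0) : ∀ t ∈ Icc a b, d t = 0 := by
  set Q : ℝ → ℝ := fun t => ∫ τ in a..t, q τ
  have hQ : ∀ t, HasDerivAt Q (q t) t := fun t => (hq.integral_hasStrictDerivAt a t).hasDerivAt
  have hQc : Continuous Q := continuous_iff_continuousAt.2 fun t => (hQ t).continuousAt
  intro t ht
  -- Integrating factor: e^{-Q} d has zero derivative.
  have key : ∫ τ in a..t, (0 : ℝ) = Real.exp (-Q t) * d t - Real.exp (-Q a) * d a := by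
    refine intervalIntegral.integral_eq_sub_of_hasDerivAt_of_le
      (f := fun t => Real.exp (-Q t) * d t) ht.1 ?_ ?_ (by simp)
    · exact (hQc.neg.rexp.continuousOn).mul (hd.mono (Icc_subset_Icc_right ht.2))
    · intro x hx
      refine ((hQ x).neg.exp.mul (hd' x ⟨hx.1, hx.2.trans_le ht.2⟩)).congr_deriv ?_
      simp only [Pi.neg_apply]
      ring
  rw [ha] at key
  simpa using key.symm

variable {H : Type*} [NormedAddCommGroup H] [InnerProductSpace ℝ H] (b : HilbertBasis ℕ ℝ H)

/-- Vectors with the same coefficients coincide. -/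
theorem ext_coeff {x y : H} (h : ∀ k, ⟪b k, x⟫_ℝ = ⟪b k, y⟫_ℝ) : x = y := by
  apply b.repr.injective
  ext k
  rw [b.repr_apply_apply, b.repr_apply_apply, h]

/-- Parseval's identity. -/
theorem norm_sq_eq_tsum (x : H) : ‖x‖ ^ 2 = ∑' k, ⟪b k, x⟫_ℝ ^ 2 := by
  rw [← real_inner_self_eq_norm_sq, ← b.tsum_inner_mul_inner]
  exact tsum_congr fun k => by rw [real_inner_comm x, sq]

theorem summable_coeff_sq (x : H) : Summable fun k => ⟪b k, x⟫_ℝ ^ 2 :=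
  (b.summable_inner_mul_inner x x).congr fun k => by rw [real_inner_comm x, sq]

/-- A sequence dominated by the coefficients of a vector is the sequence of coefficients of a
vector. -/
theorem exists_coeff {c : ℕ → ℝ} {B : H} (h : ∀ k, |c k| ≤ |⟪b k, B⟫_ℝ|) :
    ∃ y : H, ∀ k, ⟪b k, y⟫_ℝ = c k := by
  have hc : Memℓp c 2 := memℓp_gen <| by
    refine (summable_coeff_sq b B).of_nonneg_of_le (fun k => by positivity) fun k => ?_
    simpa using sq_le_sq.2 (h k)
  exact ⟨b.repr.symm ⟨c, hc⟩, fun k => by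
    rw [← b.repr_apply_apply, LinearIsometryEquiv.apply_symm_apply]⟩

theorem norm_le_of_coeff {x y : H} (h : ∀ k, |⟪b k, x⟫_ℝ| ≤ |⟪b k, y⟫_ℝ|) : ‖x‖ ≤ ‖y‖ := by
  refine le_of_sq_le_sq ?_ (norm_nonneg y)
  rw [norm_sq_eq_tsum b, norm_sq_eq_tsum b]
  exact (summable_coeff_sq b x).tsum_le_tsum (fun k => sq_le_sq.2 (h k)) (summable_coeff_sq b y)

/-- Coefficientwise continuity and a uniform majorant give continuity. -/
theorem continuousWithinAt_of_coeff {X : Type*} [TopologicalSpace X] {F : X → H} {A : Set X}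
    {x₀ : X} (hx₀ : x₀ ∈ A) (B : H) (hB : ∀ᶠ x in 𝓝[A] x₀, ∀ k, |⟪b k, F x⟫_ℝ| ≤ |⟪b k, B⟫_ℝ|)
    (hc : ∀ k, ContinuousWithinAt (fun x => ⟪b k, F x⟫_ℝ) A x₀) : ContinuousWithinAt F A x₀ := by
  have h0 := hB.self_of_nhdsWithin hx₀
  rw [ContinuousWithinAt, tendsto_iff_norm_sub_tendsto_zero]
  have hlim : Tendsto (fun x => ‖F x - F x₀‖ ^ 2) (𝓝[A] x₀) (𝓝 0) := by
    simp_rw [norm_sq_eq_tsum b]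
    have : (0 : ℝ) = ∑' _ : ℕ, (0 : ℝ) := by simp
    rw [this]
    -- The factor 4 comes from (α - β)² ≤ 2α² + 2β², both squares being at most that of the k-th
    -- coefficient of B.
    refine tendsto_tsum_of_dominated_convergence (bound := fun k => 4 * ⟪b k, B⟫_ℝ ^ 2)
      ((summable_coeff_sq b B).mul_left 4) (fun k => ?_) ?_
    · have : Tendsto (fun x => (⟪b k, F x⟫_ℝ - ⟪b k, F x₀⟫_ℝ) ^ 2) (𝓝[A] x₀)
          (𝓝 ((⟪b k, F x₀⟫_ℝ - ⟪b k, F x₀⟫_ℝ) ^ 2)) :=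
        ((hc k).sub (continuousWithinAt_const (b := ⟪b k, F x₀⟫_ℝ))).pow 2
      simpa [inner_sub_right] using this
    · filter_upwards [hB] with x hx k
      rw [Real.norm_of_nonneg (by positivity), inner_sub_right]
      have h1 := sq_le_sq.2 (hx k)
      have h2 := sq_le_sq.2 (h0 k)
      nlinarith [sq_nonneg (⟪b k, F x⟫_ℝ + ⟪b k, F x₀⟫_ℝ)]
  have := hlim.sqrt
  simpa using this

/-- The smoothing effect of a diagonal contraction semigroup. -/
theorem exists_generator_semigroup {lam : ℕ → ℝ} (hlam : ∀ k, 0 ≤ lam k) (x : H) :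
    ∃ Z : ℝ → H, ContinuousOn Z (Ioi 0) ∧ ∀ t, 0 < t → ∀ k,
      ⟪b k, Z t⟫_ℝ = Real.exp (-lam k * t) * (lam k * ⟪b k, x⟫_ℝ) := by
  -- Smoothing estimate: x e^{-x} ≤ 1 at x = λ_k a, uniformly in k. It makes a⁻¹ • x a majorant for
  -- all times t ≥ a.
  have hle : ∀ a t, 0 < a → a ≤ t → ∀ k, Real.exp (-lam k * t) * lam k ≤ a⁻¹ := by
    intro a t ha hat k
    have h1 : Real.exp (-lam k * t) ≤ Real.exp (-(lam k * a)) :=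
      Real.exp_le_exp.2 (by nlinarith [hlam k])
    have h2 : lam k * a * Real.exp (-(lam k * a)) ≤ 1 := by
      have := Real.add_one_le_exp (lam k * a)
      rw [Real.exp_neg, ← div_eq_mul_inv, div_le_one (Real.exp_pos _)]
      linarith
    rw [← one_div, le_div_iff₀ ha]
    nlinarith [mul_le_mul_of_nonneg_right h1 (mul_nonneg (hlam k) ha.le)]
  have hdom : ∀ a t, 0 < a → a ≤ t → ∀ k,
      |Real.exp (-lam k * t) * (lam k * ⟪b k, x⟫_ℝ)| ≤ |⟪b k, a⁻¹ • x⟫_ℝ| := by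
    intro a t ha hat k
    rw [← mul_assoc, abs_mul, abs_of_nonneg (mul_nonneg (Real.exp_pos _).le (hlam k)),
      inner_smul_right, abs_mul, abs_of_pos (inv_pos.2 ha)]
    exact mul_le_mul_of_nonneg_right (hle a t ha hat k) (abs_nonneg _)
  have hex : ∀ t : ℝ, ∃ y : H, 0 < t → ∀ k,
      ⟪b k, y⟫_ℝ = Real.exp (-lam k * t) * (lam k * ⟪b k, x⟫_ℝ) := fun t => by
    by_cases ht : 0 < t
    · obtain ⟨y, hy⟩ := exists_coeff b (hdom t t ht le_rfl)
      exact ⟨y, fun _ => hy⟩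
    · exact ⟨0, fun h => absurd h ht⟩
  choose Z hZ using hex
  refine ⟨Z, fun t ht => ?_, hZ⟩
  have ht0 : 0 < t / 2 := half_pos ht
  refine continuousWithinAt_of_coeff b ht ((t / 2)⁻¹ • x) ?_ fun k => ?_
  · filter_upwards [mem_nhdsWithin_of_mem_nhds (Ioi_mem_nhds (half_lt_self ht))] with τ hτ k
    rw [hZ τ (ht0.trans hτ)]
    exact hdom _ _ ht0 (le_of_lt hτ) k
  · have : ContinuousWithinAt (fun τ => Real.exp (-lam k * τ) * (lam k * ⟪b k, x⟫_ℝ)) (Ioi 0) t :=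
      Continuous.continuousWithinAt (by fun_prop)
    exact this.congr (fun τ hτ => hZ τ hτ k) (hZ t ht k)

variable [CompleteSpace H]

/-- A function with continuous candidate derivative `y`, whose coefficients have the coefficients of
`y` as derivatives, has derivative `y`. -/
theorem hasDerivWithinAt_of_coeff {T : ℝ} {V y : ℝ → H} (hV : ContinuousOn V (Ioc 0 T))
    (hy : ContinuousOn y (Ioc 0 T))
    (hd : ∀ t ∈ Ioo 0 T, ∀ k, HasDerivAt (fun t => ⟪b k, V t⟫_ℝ) ⟪b k, y t⟫_ℝ t) :
    ∀ t ∈ Ioc 0 T, HasDerivWithinAt V (y t) (Ioc 0 T) t := by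
  intro t ht
  have ha : 0 < t / 2 := half_pos ht.1
  have hat : t / 2 < t := half_lt_self ht.1
  have haT : t / 2 ≤ T := hat.le.trans ht.2
  have hsub : Icc (t / 2) T ⊆ Ioc 0 T := fun x hx => ⟨ha.trans_le hx.1, hx.2⟩
  obtain ⟨Y, hY, hYy⟩ := exists_continuous_eqOn_Icc haT (hy.mono hsub)
  -- Compared coefficient by coefficient, V is a vector-valued primitive. Starting at t/2 avoids
  -- time 0, where y is not controlled.
  have hrep : ∀ s ∈ Icc (t / 2) T, V s = V (t / 2) + ∫ τ in (t / 2)..s, Y τ := by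
    intro s hs
    refine ext_coeff b fun k => ?_
    have h1 : ∫ τ in (t / 2)..s, ⟪b k, Y τ⟫_ℝ = ⟪b k, V s⟫_ℝ - ⟪b k, V (t / 2)⟫_ℝ := by
      refine intervalIntegral.integral_eq_sub_of_hasDerivAt_of_le
        (f := fun t => ⟪b k, V t⟫_ℝ) hs.1 ?_ ?_ ?_
      · exact continuousOn_const.inner (hV.mono ((Icc_subset_Icc_right hs.2).trans hsub))
      · intro x hx
        rw [hYy ⟨hx.1.le, hx.2.le.trans hs.2⟩]
        exact hd x ⟨ha.trans hx.1, hx.2.trans_le hs.2⟩ k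
      · exact (continuous_const.inner hY).intervalIntegrable _ _
    have h2 : ∫ τ in (t / 2)..s, ⟪b k, Y τ⟫_ℝ = ⟪b k, ∫ τ in (t / 2)..s, Y τ⟫_ℝ :=
      (innerSL ℝ (b k)).intervalIntegral_comp_comm (hY.intervalIntegrable _ _)
    rw [inner_add_right, ← h2, h1]
    ring
  have hder : HasDerivAt (fun s => V (t / 2) + ∫ τ in (t / 2)..s, Y τ) (Y t) t :=
    ((hY.integral_hasStrictDerivAt (t / 2) t).hasDerivAt).const_add _
  rw [hYy ⟨hat.le, ht.2⟩] at hder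
  refine hder.hasDerivWithinAt.congr_of_eventuallyEq ?_ (hrep t ⟨hat.le, ht.2⟩)
  filter_upwards [self_mem_nhdsWithin, mem_nhdsWithin_of_mem_nhds (Ioi_mem_nhds hat)] with s hs hs'
  exact hrep s ⟨(mem_Ioi.1 hs').le, hs.2⟩

/-- The convolution of a diagonal contraction semigroup with a continuous function. -/
theorem exists_duhamel {lam : ℕ → ℝ} (hlam : ∀ k, 0 ≤ lam k) {h : ℝ → H} (hh : Continuous h)
    (a : ℝ) : ∃ W : ℝ → H, Continuous W ∧ ∀ t, a ≤ t → ∀ k,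
      ⟪b k, W t⟫_ℝ = ∫ τ in a..t, Real.exp (-lam k * (t - τ)) * ⟪b k, h τ⟫_ℝ := by
  -- Truncating time at 0 makes S a contraction for every real t, so that S is jointly continuous on
  -- ℝ × H. In the integral τ ≤ t, and the truncation has no effect.
  have hle : ∀ t k, Real.exp (-lam k * max t 0) ≤ 1 := fun t k => by
    rw [Real.exp_le_one_iff]
    nlinarith [hlam k, le_max_right t 0]
  have hex : ∀ (t : ℝ) (x : H), ∃ y : H, ∀ k,
      ⟪b k, y⟫_ℝ = Real.exp (-lam k * max t 0) * ⟪b k, x⟫_ℝ := fun t x => by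
    refine exists_coeff b (B := x) fun k => ?_
    rw [abs_mul, Real.abs_exp]
    exact mul_le_of_le_one_left (abs_nonneg _) (hle t k)
  choose S hS using hex
  have hSt : ∀ x, Continuous fun t => S t x := fun x => by
    rw [← continuousOn_univ]
    intro t _
    refine continuousWithinAt_of_coeff b (mem_univ t) x (Eventually.of_forall fun t k => ?_)
      fun k => ?_
    · rw [hS, abs_mul, Real.abs_exp]
      exact mul_le_of_le_one_left (abs_nonneg _) (hle t k)
    · simp_rw [hS]
      exact Continuous.continuousWithinAt (by fun_prop)
  have hSx : ∀ t x y, ‖S t x - S t y‖ ≤ ‖x - y‖ := fun t x y => by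
    refine norm_le_of_coeff b fun k => ?_
    rw [inner_sub_right, inner_sub_right, hS, hS, ← mul_sub, abs_mul, Real.abs_exp]
    exact mul_le_of_le_one_left (abs_nonneg _) (hle t k)
  have hScont : Continuous fun z : ℝ × H => S z.1 z.2 := by
    refine continuous_prod_of_continuous_lipschitzWith' (fun z : ℝ × H => S z.1 z.2) 1
      (fun t => LipschitzWith.of_dist_le_mul fun x y => ?_) hSt
    simpa [dist_eq_norm] using hSx t x y
  have hint : Continuous fun z : ℝ × ℝ => S (z.1 - z.2) (h z.2) :=
    hScont.comp ((continuous_fst.sub continuous_snd).prodMk (hh.comp continuous_snd))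
  refine ⟨fun t => ∫ τ in a..t, S (t - τ) (h τ),
    intervalIntegral.continuous_parametric_intervalIntegral_of_continuous hint continuous_id, ?_⟩
  intro t ht k
  have h2 : ∫ τ in a..t, ⟪b k, S (t - τ) (h τ)⟫_ℝ = ⟪b k, ∫ τ in a..t, S (t - τ) (h τ)⟫_ℝ :=
    (innerSL ℝ (b k)).intervalIntegral_comp_comm
      ((hint.comp (continuous_const.prodMk continuous_id)).intervalIntegrable _ _)
  rw [← h2]
  refine intervalIntegral.integral_congr fun τ hτ => ?_
  rw [uIcc_of_le ht] at hτ
  simp only [hS, max_eq_left (sub_nonneg.2 hτ.2)]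

/-- The abstract parabolic Cauchy problem for a nonnegative diagonal operator: the mild solution with
a source that is continuous up to `0` and continuously differentiable for positive times is a
classical solution. -/
theorem exists_classical_solution {lam : ℕ → ℝ} (hlam : ∀ k, 0 ≤ lam k) {T : ℝ} (φ : H)
    {g : ℝ → H} (hg : Continuous g) (hg' : ContDiffOn ℝ 1 g (Ioc 0 T)) :
    ∃ V y : ℝ → H, ContinuousOn V (Icc 0 T) ∧ ContinuousOn y (Ioc 0 T) ∧
      (∀ t ∈ Ioc 0 T, HasDerivWithinAt V (y t) (Ioc 0 T) t) ∧
      (∀ t ∈ Icc 0 T, ∀ k, ⟪b k, V t⟫_ℝ = Real.exp (-lam k * t) * ⟪b k, φ⟫_ℝ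
        + ∫ τ in (0 : ℝ)..t, Real.exp (-lam k * (t - τ)) * ⟪b k, g τ⟫_ℝ) ∧
      ∀ t ∈ Ioc 0 T, ∀ k, ⟪b k, y t⟫_ℝ = ⟪b k, g t⟫_ℝ - lam k * ⟪b k, V t⟫_ℝ := by
  have hle : ∀ t k, 0 ≤ t → |Real.exp (-lam k * t) * ⟪b k, φ⟫_ℝ| ≤ |⟪b k, φ⟫_ℝ| := by
    intro t k ht
    rw [abs_mul, Real.abs_exp]
    refine mul_le_of_le_one_left (abs_nonneg _) (Real.exp_le_one_iff.2 ?_)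
    nlinarith [hlam k]
  have hex : ∀ t : ℝ, ∃ x : H, 0 ≤ t → ∀ k, ⟪b k, x⟫_ℝ = Real.exp (-lam k * t) * ⟪b k, φ⟫_ℝ := by
    intro t
    by_cases ht : 0 ≤ t
    · obtain ⟨x, hx⟩ := exists_coeff b (fun k => hle t k ht)
      exact ⟨x, fun _ => hx⟩
    · exact ⟨0, fun h => absurd h ht⟩
  choose X hX using hex
  have hXc : ContinuousOn X (Icc 0 T) := fun t ht => by
    refine continuousWithinAt_of_coeff b ht φ ?_ fun k => ?_
    · filter_upwards [self_mem_nhdsWithin] with τ hτ k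
      rw [hX τ hτ.1]
      exact hle τ k hτ.1
    · have : ContinuousWithinAt (fun τ => Real.exp (-lam k * τ) * ⟪b k, φ⟫_ℝ) (Icc 0 T) t :=
        Continuous.continuousWithinAt (by fun_prop)
      exact this.congr (fun τ hτ => hX τ hτ.1 k) (hX t ht.1 k)
  obtain ⟨W, hW, hWk⟩ := exists_duhamel b hlam hg 0
  set V : ℝ → H := fun t => X t + W t with hVdef
  have hVc : ContinuousOn V (Icc 0 T) := hXc.add hW.continuousOn
  have hVk : ∀ t ∈ Icc 0 T, ∀ k, ⟪b k, V t⟫_ℝ = Real.exp (-lam k * t) * ⟪b k, φ⟫_ℝ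
        + ∫ τ in (0 : ℝ)..t, Real.exp (-lam k * (t - τ)) * ⟪b k, g τ⟫_ℝ := fun t ht k => by
    rw [hVdef, inner_add_right, hX t ht.1, hWk t ht.1]
  have hgk : ∀ k, Continuous fun t => ⟪b k, g t⟫_ℝ := fun k => continuous_const.inner hg
  have hVd : ∀ t ∈ Ioo 0 T, ∀ k,
      HasDerivAt (fun t => ⟪b k, V t⟫_ℝ) (⟪b k, g t⟫_ℝ - lam k * ⟪b k, V t⟫_ℝ) t := by
    intro t ht k
    have h1 := hasDerivAt_duhamel (lam k) ⟪b k, φ⟫_ℝ 0 (hgk k) t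
    simp only [sub_zero] at h1
    rw [← hVk t (Ioo_subset_Icc_self ht)] at h1
    refine h1.congr_of_eventuallyEq ?_
    filter_upwards [Ioo_mem_nhds ht.1 ht.2] with τ hτ
    exact hVk τ (Ioo_subset_Icc_self hτ) k
  have hud : UniqueDiffOn ℝ (Ioc (0 : ℝ) T) := uniqueDiffOn_Ioc 0 T
  obtain ⟨hgdiff, hgder⟩ := (contDiffOn_one_iff_derivWithin hud).1 hg'
  -- The candidate derivative g - AV is built on (a, T] as the solution of y' + Ay = g' started at
  -- g(a) - AV(a): `X₁` propagates g(a), `Z₁` is the smoothed AV(a), and `W₁` is the convolution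
  -- with g'.
  have hloc : ∀ a, 0 < a → ∃ y : ℝ → H, ContinuousOn y (Ioc a T) ∧
      ∀ t ∈ Ioc a T, ∀ k, ⟪b k, y t⟫_ℝ = ⟪b k, g t⟫_ℝ - lam k * ⟪b k, V t⟫_ℝ := by
    intro a ha
    rcases lt_or_ge T a with haT | haT
    · exact ⟨0, by simp [Ioc_eq_empty_of_le haT.le], fun t ht => absurd (ht.1.trans_le ht.2)
        (not_lt.2 haT.le)⟩
    have hsub : Icc a T ⊆ Ioc 0 T := fun x hx => ⟨ha.trans_le hx.1, hx.2⟩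
    obtain ⟨g₁, hg₁, hg₁e⟩ := exists_continuous_eqOn_Icc haT (hgder.mono hsub)
    have hg₁k : ∀ k, Continuous fun t => ⟪b k, g₁ t⟫_ℝ := fun k => continuous_const.inner hg₁
    have hgd : ∀ t ∈ Ioo a T, ∀ k, HasDerivAt (fun t => ⟪b k, g t⟫_ℝ) ⟪b k, g₁ t⟫_ℝ t := by
      intro t ht k
      have h1 : HasDerivAt g (g₁ t) t := by
        rw [hg₁e (Ioo_subset_Icc_self ht)]
        exact ((hgdiff t (hsub (Ioo_subset_Icc_self ht))).hasDerivWithinAt).hasDerivAt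
          (Ioc_mem_nhds (ha.trans ht.1) ht.2)
      simpa using (hasDerivAt_const t (b k)).inner ℝ h1
    obtain ⟨W₁, hW₁, hW₁k⟩ := exists_duhamel b hlam hg₁ a
    obtain ⟨Z₁, hZ₁, hZ₁k⟩ := exists_generator_semigroup b hlam (V a)
    have hex' : ∀ t : ℝ, ∃ x : H, a ≤ t → ∀ k,
        ⟪b k, x⟫_ℝ = Real.exp (-lam k * (t - a)) * ⟪b k, g a⟫_ℝ := by
      intro t
      by_cases ht : a ≤ t
      · obtain ⟨x, hx⟩ := exists_coeff (c := fun k => Real.exp (-lam k * (t - a)) * ⟪b k, g a⟫_ℝ)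
          (B := g a) b (fun k => by
            rw [abs_mul, Real.abs_exp]
            refine mul_le_of_le_one_left (abs_nonneg _) (Real.exp_le_one_iff.2 ?_)
            nlinarith [hlam k])
        exact ⟨x, fun _ => hx⟩
      · exact ⟨0, fun h => absurd h ht⟩
    choose X₁ hX₁ using hex'
    have hX₁c : ContinuousOn X₁ (Ioc a T) := fun t ht => by
      refine continuousWithinAt_of_coeff b ht (g a) ?_ fun k => ?_
      · filter_upwards [self_mem_nhdsWithin] with τ hτ k
        rw [hX₁ τ hτ.1.le, abs_mul, Real.abs_exp]
        refine mul_le_of_le_one_left (abs_nonneg _) (Real.exp_le_one_iff.2 ?_)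
        nlinarith [hlam k, hτ.1]
      · have : ContinuousWithinAt (fun τ => Real.exp (-lam k * (τ - a)) * ⟪b k, g a⟫_ℝ)
            (Ioc a T) t := Continuous.continuousWithinAt (by fun_prop)
        exact this.congr (fun τ hτ => hX₁ τ hτ.1.le k) (hX₁ t ht.1.le k)
    refine ⟨fun t => X₁ t - Z₁ (t - a) + W₁ t, ?_, fun t ht k => ?_⟩
    · refine (hX₁c.sub (hZ₁.comp (continuousOn_id.sub continuousOn_const) ?_)).add
        hW₁.continuousOn
      intro t ht
      simpa using ht.1
    · set r : ℝ → ℝ := fun t =>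
        Real.exp (-lam k * (t - a)) * (⟪b k, g a⟫_ℝ - lam k * ⟪b k, V a⟫_ℝ)
          + ∫ τ in a..t, Real.exp (-lam k * (t - τ)) * ⟪b k, g₁ τ⟫_ℝ with hr
      have hrd : ∀ t, HasDerivAt r (⟪b k, g₁ t⟫_ℝ - lam k * r t) t :=
        hasDerivAt_duhamel (lam k) _ a (hg₁k k)
      -- Both g_k - λ_k V_k and r solve r' = (g')_k - λ_k r with the same value at a, so their
      -- difference vanishes.
      have hzero := eqOn_zero_of_hasDerivAt_mul (q := fun _ => -lam k)
        (d := fun t => (⟪b k, g t⟫_ℝ - lam k * ⟪b k, V t⟫_ℝ) - r t) (a := a) (b := T)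
        continuous_const ?_ ?_ ?_ t ⟨ht.1.le, ht.2⟩
      · rw [inner_add_right, inner_sub_right, hX₁ t ht.1.le, hZ₁k _ (sub_pos.2 ht.1),
          hW₁k t ht.1.le]
        simp only [hr] at hzero
        linear_combination -hzero
      · refine ((hgk k).continuousOn.sub (continuousOn_const.mul
          (continuousOn_const.inner (hVc.mono (Icc_subset_Icc_left ha.le))))).sub ?_
        exact fun t _ => (hrd t).continuousAt.continuousWithinAt
      · intro t ht
        refine (((hgd t ht k).sub ((hVd t ⟨ha.trans ht.1, ht.2⟩ k).const_mul (lam k))).sub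
          (hrd t)).congr_deriv ?_
        ring
      · simp [hr]
  have hglob : ∀ t : ℝ, ∃ x : H, t ∈ Ioc 0 T → ∀ k,
      ⟪b k, x⟫_ℝ = ⟪b k, g t⟫_ℝ - lam k * ⟪b k, V t⟫_ℝ := by
    intro t
    by_cases ht : t ∈ Ioc 0 T
    · obtain ⟨y, -, hy⟩ := hloc (t / 2) (half_pos ht.1)
      exact ⟨y t, fun _ => hy t ⟨half_lt_self ht.1, ht.2⟩⟩
    · exact ⟨0, fun h => absurd h ht⟩
  choose y hy using hglob
  have hyc : ContinuousOn y (Ioc 0 T) := by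
    intro t ht
    obtain ⟨y₁, hy₁, hy₁k⟩ := hloc (t / 2) (half_pos ht.1)
    have hat : t / 2 < t := half_lt_self ht.1
    have heq : EqOn y y₁ (Ioc (t / 2) T) := fun τ hτ => ext_coeff b fun k => by
      rw [hy τ ⟨(half_pos ht.1).trans hτ.1, hτ.2⟩, hy₁k τ hτ]
    have h1 : ContinuousWithinAt y (Ioc (t / 2) T) t :=
      (hy₁ t ⟨hat, ht.2⟩).congr heq (heq ⟨hat, ht.2⟩)
    refine h1.mono_of_mem_nhdsWithin ?_
    filter_upwards [self_mem_nhdsWithin, mem_nhdsWithin_of_mem_nhds (Ioi_mem_nhds hat)]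
      with s hs hs'
    exact ⟨hs', hs.2⟩
  refine ⟨V, y, hVc, hyc, ?_, hVk, hy⟩
  refine hasDerivWithinAt_of_coeff b (hVc.mono Ioc_subset_Icc_self) hyc fun t ht k => ?_
  rw [hy t (Ioo_subset_Ioc_self ht)]
  exact hVd t ht k

end Evolution

/-! ### The Hilbert space of the form, and its resolvent. -/

section FormDomain

open scoped InnerProductSpace

theorem inner_submodule_prod {E F : Type*} [NormedAddCommGroup E] [InnerProductSpace ℝ E]
    [NormedAddCommGroup F] [InnerProductSpace ℝ F] {G : Submodule ℝ (WithLp 2 (E × F))} (z w : G) :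
    ⟪z, w⟫_ℝ = ⟪z.1.fst, w.1.fst⟫_ℝ + ⟪z.1.snd, w.1.snd⟫_ℝ := by
  rw [Submodule.coe_inner, WithLp.prod_inner_apply]
  rfl

/-- The resolvent of the operator of a form `a` whose form domain is compactly and densely embedded
by `J`. -/
theorem exists_resolvent_of_form {E G : Type*} [NormedAddCommGroup E] [InnerProductSpace ℝ E]
    [CompleteSpace E] [NormedAddCommGroup G] [InnerProductSpace ℝ G] [CompleteSpace G]
    (J : G →L[ℝ] E) {P : E → Prop} {a : E → E → ℝ} (hP : ∀ z, P (J z))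
    (hP' : ∀ u, P u → ∃ z, J z = u) (hinner : ∀ z w, ⟪z, w⟫_ℝ = ⟪J z, J w⟫_ℝ + a (J z) (J w))
    (hcomp : IsCompactOperator J) (hdense : ∀ x, (∀ z, ⟪x, J z⟫_ℝ = 0) → x = 0) :
    ∃ T : E →L[ℝ] E, IsCompactOperator T ∧ T.toLinearMap.IsSymmetric ∧
      (∀ x, x ≠ 0 → 0 < ⟪T x, x⟫_ℝ) ∧ (∀ x, P (T x)) ∧
      ∀ u x, P u → (u = T x ↔ ∀ v, P v → a u v + ⟪u, v⟫_ℝ = ⟪x, v⟫_ℝ) := by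
  -- The resolvent is J J*. By Riesz, J* x represents z ↦ ⟪x, J z⟫ in the form inner product, which
  -- is the weak equation; ⟪J J* x, x⟫ = ‖J* x‖² is positive because dense range of J makes J*
  -- injective.
  have hT : ∀ x, (J.comp (ContinuousLinearMap.adjoint J)) x = J (ContinuousLinearMap.adjoint J x) :=
    fun x => rfl
  have hadj : ∀ x z, ⟪ContinuousLinearMap.adjoint J x, z⟫_ℝ = ⟪x, J z⟫_ℝ :=
    fun x z => ContinuousLinearMap.adjoint_inner_left J z x
  have hadj' : ∀ x z, ⟪z, ContinuousLinearMap.adjoint J x⟫_ℝ = ⟪J z, x⟫_ℝ :=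
    fun x z => ContinuousLinearMap.adjoint_inner_right J z x
  refine ⟨J.comp (ContinuousLinearMap.adjoint J), hcomp.comp_clm _, fun x y => ?_, fun x hx => ?_,
    fun x => hP _, fun u x hu => ⟨?_, fun h => ?_⟩⟩
  · simp only [ContinuousLinearMap.coe_coe, hT]
    rw [← hadj', ← hadj]
  · rw [hT, ← hadj', real_inner_self_eq_norm_sq]
    have : ContinuousLinearMap.adjoint J x ≠ 0 := fun h => hx (hdense x fun z => by
      rw [← hadj, h, inner_zero_left])
    positivity
  · rintro rfl v hv
    obtain ⟨z, rfl⟩ := hP' v hv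
    rw [hT, add_comm, ← hinner, hadj]
  · obtain ⟨z, rfl⟩ := hP' u hu
    rw [hT]
    congr 1
    refine ext_inner_right ℝ fun w => ?_
    rw [hadj, ← h _ (hP w), hinner, add_comm]

variable {n : ℕ}

/-- The fractional difference quotient `(u x - u y) / |x - y| ^ ((n + 2 s) / 2)`. -/
def diffQuot (s : ℝ) (u : Space n → ℝ) (z : Space n × Space n) : ℝ :=
  (u z.1 - u z.2) / ‖z.1 - z.2‖ ^ (((n : ℝ) + 2 * s) / 2)

/-- Lets modifications of u on null sets pass to `diffQuot` on the product space. -/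
theorem ae_prod_of_ae {p : Space n → Prop} (h : ∀ᵐ x ∂(volume : Measure (Space n)), p x) :
    ∀ᵐ z ∂(volume : Measure (Space n × Space n)), p z.1 ∧ p z.2 :=
  (Measure.quasiMeasurePreserving_fst.ae h).and (Measure.quasiMeasurePreserving_snd.ae h)

theorem diffQuot_congr (s : ℝ) {u v : Space n → ℝ} (h : u =ᵐ[volume] v) :
    diffQuot s u =ᵐ[volume] diffQuot s v := by
  filter_upwards [ae_prod_of_ae h] with z hz
  rw [diffQuot, diffQuot, hz.1, hz.2]

theorem aestronglyMeasurable_diffQuot (s : ℝ) {u : Space n → ℝ} (hu : AEMeasurable u volume) :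
    AEStronglyMeasurable (diffQuot s u) volume := by
  have h1 : AEMeasurable (fun z : Space n × Space n => u z.1) volume :=
    hu.comp_quasiMeasurePreserving Measure.quasiMeasurePreserving_fst
  have h2 : AEMeasurable (fun z : Space n × Space n => u z.2) volume :=
    hu.comp_quasiMeasurePreserving Measure.quasiMeasurePreserving_snd
  have h3 : Measurable (fun z : Space n × Space n => ‖z.1 - z.2‖ ^ (((n : ℝ) + 2 * s) / 2)) :=
    (measurable_fst.sub measurable_snd).norm.pow_const _
  exact ((h1.sub h2).div h3.aemeasurable).aestronglyMeasurable

theorem diffQuot_mul (s : ℝ) (u v : Space n → ℝ) (z : Space n × Space n) :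
    diffQuot s u z * diffQuot s v z
      = (u z.1 - u z.2) * (v z.1 - v z.2) / ‖z.1 - z.2‖ ^ ((n : ℝ) + 2 * s) := by
  rw [diffQuot, diffQuot, div_mul_div_comm, ← sq, ← Real.rpow_natCast, ← Real.rpow_mul
    (norm_nonneg _)]
  norm_num

theorem innerH0s_eq_integral (s : ℝ) (u v : Space n → ℝ) :
    innerH0s s u v = ∫ z, diffQuot s u z * diffQuot s v z := by
  simp_rw [innerH0s, diffQuot_mul]

theorem innerH0s_comm (s : ℝ) (u v : Space n → ℝ) : innerH0s s u v = innerH0s s v u := by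
  simp_rw [innerH0s, mul_comm]

theorem innerH0s_congr (s : ℝ) {u u' v v' : Space n → ℝ} (hu : u =ᵐ[volume] u')
    (hv : v =ᵐ[volume] v') : innerH0s s u v = innerH0s s u' v' := by
  rw [innerH0s_eq_integral, innerH0s_eq_integral]
  refine integral_congr_ae ?_
  filter_upwards [diffQuot_congr s hu, diffQuot_congr s hv] with z h1 h2
  rw [h1, h2]

theorem innerH0s_self_nonneg (s : ℝ) (u : Space n → ℝ) : 0 ≤ innerH0s s u u := by
  rw [innerH0s_eq_integral]
  exact integral_nonneg fun z => mul_self_nonneg _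

variable {Ω : Set (Space n)} {s : ℝ}

theorem aemeasurable_zeroExt (hΩ : MeasurableSet Ω) (u : L2 Ω) :
    AEMeasurable (zeroExt Ω u) volume :=
  (aemeasurable_indicator_iff hΩ).2 (Lp.aestronglyMeasurable u).aemeasurable

theorem zeroExt_ae_eq_restrict (hΩ : MeasurableSet Ω) (u : L2 Ω) :
    zeroExt Ω u =ᵐ[volume.restrict Ω] u :=
  indicator_ae_eq_restrict hΩ

theorem zeroExt_ae_eq_of (hΩ : MeasurableSet Ω) {u : L2 Ω} {v : Space n → ℝ}
    (h : u =ᵐ[volume.restrict Ω] v) (hv : ∀ᵐ x ∂(volume.restrict Ωᶜ), v x = 0) :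
    zeroExt Ω u =ᵐ[volume] v := by
  filter_upwards [(ae_restrict_iff' hΩ).1 h, (ae_restrict_iff' hΩ.compl).1 hv] with x h1 h2
  by_cases hx : x ∈ Ω
  · rw [zeroExt, indicator_of_mem hx, h1 hx]
  · rw [zeroExt, indicator_of_notMem hx, h2 hx]

theorem zeroExt_add (hΩ : MeasurableSet Ω) (u v : L2 Ω) :
    zeroExt Ω (u + v) =ᵐ[volume] zeroExt Ω u + zeroExt Ω v := by
  refine zeroExt_ae_eq_of hΩ ?_ ?_
  · filter_upwards [Lp.coeFn_add u v, zeroExt_ae_eq_restrict hΩ u, zeroExt_ae_eq_restrict hΩ v]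
      with x h1 h2 h3
    rw [h1, Pi.add_apply, Pi.add_apply, h2, h3]
  · filter_upwards [ae_restrict_mem hΩ.compl] with x hx
    simp [zeroExt, indicator_of_notMem hx]

theorem zeroExt_sub (hΩ : MeasurableSet Ω) (u v : L2 Ω) :
    zeroExt Ω (u - v) =ᵐ[volume] zeroExt Ω u - zeroExt Ω v := by
  refine zeroExt_ae_eq_of hΩ ?_ ?_
  · filter_upwards [Lp.coeFn_sub u v, zeroExt_ae_eq_restrict hΩ u, zeroExt_ae_eq_restrict hΩ v]
      with x h1 h2 h3
    rw [h1, Pi.sub_apply, Pi.sub_apply, h2, h3]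
  · filter_upwards [ae_restrict_mem hΩ.compl] with x hx
    simp [zeroExt, indicator_of_notMem hx]

theorem zeroExt_smul (hΩ : MeasurableSet Ω) (c : ℝ) (u : L2 Ω) :
    zeroExt Ω (c • u) =ᵐ[volume] c • zeroExt Ω u := by
  refine zeroExt_ae_eq_of hΩ ?_ ?_
  · filter_upwards [Lp.coeFn_smul c u, zeroExt_ae_eq_restrict hΩ u] with x h1 h2
    rw [h1, Pi.smul_apply, Pi.smul_apply, h2]
  · filter_upwards [ae_restrict_mem hΩ.compl] with x hx
    simp [zeroExt, indicator_of_notMem hx]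

theorem zeroExt_zero (hΩ : MeasurableSet Ω) : zeroExt Ω (0 : L2 Ω) =ᵐ[volume] 0 := by
  refine zeroExt_ae_eq_of hΩ (Lp.coeFn_zero _ _ _) (by simp)

theorem inner_eq_integral (u v : L2 Ω) : ⟪u, v⟫_ℝ = ∫ x in Ω, u x * v x := by
  rw [L2.inner_def]
  exact integral_congr_ae (Eventually.of_forall fun x => by simp [mul_comm])

theorem measurableSet_crossSet (hΩ : MeasurableSet Ω) : MeasurableSet (crossSet Ω) :=
  (hΩ.compl.prod hΩ.compl).compl

/-- The difference quotient of an element of `ℍ₀ˢ(Ω)` is square integrable on the whole space. -/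
theorem MemH0s.memLp_diffQuot (hΩ : MeasurableSet Ω) {u : Space n → ℝ} (hu : MemH0s s Ω u) :
    MemLp (diffQuot s u) 2 volume := by
  have h1 : MemLp ((crossSet Ω).indicator (diffQuot s u)) 2 volume :=
    (memLp_indicator_iff_restrict (measurableSet_crossSet hΩ)).2 hu.memHs.memLp_quotient
  refine h1.ae_eq ?_
  filter_upwards [ae_prod_of_ae ((ae_restrict_iff' hΩ.compl).1 hu.ae_eq_zero)] with z hz
  by_cases h : z ∈ crossSet Ω
  · rw [indicator_of_mem h]
  · rw [indicator_of_notMem h]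
    rw [crossSet, mem_compl_iff, not_not] at h
    rw [diffQuot, hz.1 h.1, hz.2 h.2, sub_zero, zero_div]

theorem memH0s_zeroExt_of_memLp (hΩ : MeasurableSet Ω) (u : L2 Ω)
    (hu : MemLp (diffQuot s (zeroExt Ω u)) 2 volume) : MemH0s s Ω (zeroExt Ω u) where
  memHs := ⟨aemeasurable_zeroExt hΩ u, (Lp.memLp u).ae_eq (zeroExt_ae_eq_restrict hΩ u).symm,
    hu.restrict _⟩
  ae_eq_zero := by
    filter_upwards [ae_restrict_mem hΩ.compl] with x hx
    rw [zeroExt, indicator_of_notMem hx]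

theorem MemH0s.congr_zeroExt (hΩ : MeasurableSet Ω) {v : Space n → ℝ} (hv : MemH0s s Ω v) :
    zeroExt Ω (hv.memHs.memLp.toLp v) =ᵐ[volume] v :=
  zeroExt_ae_eq_of hΩ hv.memHs.memLp.coeFn_toLp hv.ae_eq_zero

theorem MemH0s.zeroExt_toLp (hΩ : MeasurableSet Ω) {v : Space n → ℝ} (hv : MemH0s s Ω v) :
    MemH0s s Ω (zeroExt Ω (hv.memHs.memLp.toLp v)) :=
  memH0s_zeroExt_of_memLp hΩ _
    ((hv.memLp_diffQuot hΩ).ae_eq (diffQuot_congr s (hv.congr_zeroExt hΩ)).symm)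

theorem integral_mul_toLp (w : L2 Ω) {v : Space n → ℝ} (hv : MemLp v 2 (volume.restrict Ω)) :
    ∫ x in Ω, w x * v x = ⟪w, hv.toLp v⟫_ℝ := by
  rw [inner_eq_integral]
  refine integral_congr_ae ?_
  filter_upwards [hv.coeFn_toLp] with x hx
  rw [hx]

theorem integral_mul_zeroExt (hΩ : MeasurableSet Ω) (w v : L2 Ω) :
    ∫ x in Ω, w x * zeroExt Ω v x = ⟪w, v⟫_ℝ := by
  rw [inner_eq_integral]
  refine integral_congr_ae ?_
  filter_upwards [zeroExt_ae_eq_restrict hΩ v] with x hx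
  rw [hx]

/-- The graph of the map sending `u ∈ ℍ₀ˢ(Ω)` to its difference quotient. -/
def formGraph (s : ℝ) (hΩ : MeasurableSet Ω) :
    Submodule ℝ (WithLp 2 (L2 Ω × Lp ℝ 2 (volume : Measure (Space n × Space n)))) where
  carrier := {z | z.snd =ᵐ[volume] diffQuot s (zeroExt Ω z.fst)}
  add_mem' := by
    intro a b ha hb
    filter_upwards [ha, hb, Lp.coeFn_add a.snd b.snd,
      diffQuot_congr s (zeroExt_add hΩ a.fst b.fst)] with z h1 h2 h3 h4
    rw [WithLp.add_snd, WithLp.add_fst, h3, h4, Pi.add_apply, h1, h2]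
    simp only [diffQuot, Pi.add_apply]
    ring
  zero_mem' := by
    filter_upwards [Lp.coeFn_zero ℝ 2 (volume : Measure (Space n × Space n)),
      diffQuot_congr s (zeroExt_zero hΩ)] with z h1 h2
    rw [WithLp.zero_snd, WithLp.zero_fst, h1, h2]
    simp [diffQuot]
  smul_mem' := by
    intro c a ha
    filter_upwards [ha, Lp.coeFn_smul c a.snd, diffQuot_congr s (zeroExt_smul hΩ c a.fst)]
      with z h1 h3 h4
    rw [WithLp.smul_snd, WithLp.smul_fst, h3, h4, Pi.smul_apply, h1]
    simp only [diffQuot, Pi.smul_apply, smul_eq_mul]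
    ring

theorem mem_formGraph {hΩ : MeasurableSet Ω}
    {z : WithLp 2 (L2 Ω × Lp ℝ 2 (volume : Measure (Space n × Space n)))} :
    z ∈ formGraph s hΩ ↔ z.snd =ᵐ[volume] diffQuot s (zeroExt Ω z.fst) := Iff.rfl

/-- Gives completeness of the form domain. Two successive extractions make both components converge
almost everywhere, and the difference quotient passes to pointwise limits. -/
theorem isClosed_formGraph (hΩ : MeasurableSet Ω) :
    IsClosed (formGraph s hΩ : Set (WithLp 2 (L2 Ω × Lp ℝ 2 (volume : Measure
      (Space n × Space n))))) := by
  refine IsSeqClosed.isClosed fun z w hz hw => ?_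
  have h1 : Tendsto (fun m => (z m).fst) atTop (𝓝 w.fst) :=
    ((WithLp.fstL 2 ℝ _ _).continuous.tendsto w).comp hw
  have h2 : Tendsto (fun m => (z m).snd) atTop (𝓝 w.snd) :=
    ((WithLp.sndL 2 ℝ _ _).continuous.tendsto w).comp hw
  obtain ⟨ψ, hψ, hψlim⟩ := (tendstoInMeasure_of_tendsto_Lp h1).exists_seq_tendsto_ae
  obtain ⟨χ, hχ, hχlim⟩ := (tendstoInMeasure_of_tendsto_Lp
    (h2.comp hψ.tendsto_atTop)).exists_seq_tendsto_ae
  rw [SetLike.mem_coe, mem_formGraph]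
  filter_upwards [hχlim, ae_prod_of_ae ((ae_restrict_iff' hΩ).1 hψlim),
    ae_all_iff.2 fun m => mem_formGraph.1 (hz m)] with x hx1 hx2 hx3
  have hext : ∀ y : Space n, (y ∈ Ω → Tendsto (fun m => (z (ψ m)).fst y) atTop (𝓝 (w.fst y))) →
      Tendsto (fun m => zeroExt Ω (z (ψ m)).fst y) atTop (𝓝 (zeroExt Ω w.fst y)) := by
    intro y hy
    by_cases hyΩ : y ∈ Ω
    · simpa [zeroExt, hyΩ] using hy hyΩ
    · simp [zeroExt, hyΩ]
  have hlim : Tendsto (fun m => diffQuot s (zeroExt Ω (z (ψ (χ m))).fst) x) atTop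
      (𝓝 (diffQuot s (zeroExt Ω w.fst) x)) :=
    ((((hext _ hx2.1).comp hχ.tendsto_atTop).sub
      ((hext _ hx2.2).comp hχ.tendsto_atTop)).div_const _)
  refine tendsto_nhds_unique hx1 (hlim.congr fun m => ?_)
  rw [← hx3]; rfl

/-- The form domain as a subspace of `L²(Ω)`: the projection of the graph to `L²(Ω)`. -/
def formProj (s : ℝ) (hΩ : MeasurableSet Ω) : formGraph s hΩ →L[ℝ] L2 Ω :=
  (WithLp.fstL 2 ℝ _ _).comp (formGraph s hΩ).subtypeL

theorem formProj_apply (hΩ : MeasurableSet Ω) (z : formGraph s hΩ) :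
    formProj s hΩ z = z.1.fst := rfl

theorem memH0s_formProj (hΩ : MeasurableSet Ω) (z : formGraph s hΩ) :
    MemH0s s Ω (zeroExt Ω (formProj s hΩ z)) :=
  memH0s_zeroExt_of_memLp hΩ _ ((Lp.memLp z.1.snd).ae_eq (mem_formGraph.1 z.2))

theorem exists_formProj_eq (hΩ : MeasurableSet Ω) {u : L2 Ω} (hu : MemH0s s Ω (zeroExt Ω u)) :
    ∃ z : formGraph s hΩ, formProj s hΩ z = u :=
  ⟨⟨WithLp.toLp 2 (u, (hu.memLp_diffQuot hΩ).toLp _), (hu.memLp_diffQuot hΩ).coeFn_toLp⟩, rfl⟩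

theorem formGraph_inner (hΩ : MeasurableSet Ω) (z w : formGraph s hΩ) :
    ⟪z, w⟫_ℝ = ⟪formProj s hΩ z, formProj s hΩ w⟫_ℝ
      + innerH0s s (zeroExt Ω (formProj s hΩ z)) (zeroExt Ω (formProj s hΩ w)) := by
  refine (inner_submodule_prod (G := formGraph s hΩ) z w).trans ?_
  rw [innerH0s_eq_integral]
  refine congrArg₂ (· + ·) rfl ?_
  rw [L2.inner_def]
  refine integral_congr_ae ?_
  filter_upwards [mem_formGraph.1 z.2, mem_formGraph.1 w.2] with x h1 h2
  change ⟪z.1.snd x, w.1.snd x⟫_ℝ = _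
  rw [h1, h2]
  exact mul_comm _ _

/-- The resolvent `(1 + (-Δ)ˢ)⁻¹` of the Dirichlet fractional Laplacian, given compactness and density
of the embedding of the form domain. -/
theorem exists_resolvent (hΩ : MeasurableSet Ω) (hcomp : IsCompactOperator (formProj s hΩ))
    (hdense : ∀ x : L2 Ω, (∀ z, ⟪x, formProj s hΩ z⟫_ℝ = 0) → x = 0) :
    ∃ T : L2 Ω →L[ℝ] L2 Ω, IsCompactOperator T ∧ T.toLinearMap.IsSymmetric ∧
      (∀ x, x ≠ 0 → 0 < ⟪T x, x⟫_ℝ) ∧ (∀ x, MemH0s s Ω (zeroExt Ω (T x))) ∧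
      ∀ u x : L2 Ω, MemH0s s Ω (zeroExt Ω u) → (u = T x ↔ ∀ v : L2 Ω, MemH0s s Ω (zeroExt Ω v) →
        innerH0s s (zeroExt Ω u) (zeroExt Ω v) + ⟪u, v⟫_ℝ = ⟪x, v⟫_ℝ) := by
  have : CompleteSpace (formGraph s hΩ) := (isClosed_formGraph hΩ).completeSpace_coe
  exact exists_resolvent_of_form (formProj s hΩ) (P := fun u => MemH0s s Ω (zeroExt Ω u))
    (a := fun u v => innerH0s s (zeroExt Ω u) (zeroExt Ω v)) (memH0s_formProj hΩ)
    (fun u hu => exists_formProj_eq hΩ hu) (formGraph_inner hΩ) hcomp hdense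

end FormDomain

/-! ### Compactness of the embedding by approximation on a grid of cubes. -/

section Compactness

open scoped ENNReal

/-- An operator that is approximated by finite dimensional subspaces, uniformly on the unit ball, is
compact. -/
theorem isCompactOperator_of_finiteDimensional_approx {E G : Type*} [NormedAddCommGroup E]
    [InnerProductSpace ℝ E] [CompleteSpace E] [NormedAddCommGroup G] [InnerProductSpace ℝ G]
    (J : G →L[ℝ] E) (h : ∀ ε : ℝ, 0 < ε → ∃ S : Submodule ℝ E, FiniteDimensional ℝ S ∧
      ∀ z, ∃ y ∈ S, ‖J z - y‖ ≤ ε * ‖z‖) : IsCompactOperator J := by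
  have hcl := isClosed_setOfPred_isCompactOperator (σ₁₂ := RingHom.id ℝ) (M₁ := G) (M₂ := E)
  change J ∈ {f : G →L[ℝ] E | IsCompactOperator f}
  rw [← hcl.closure_eq, Metric.mem_closure_iff]
  intro ε hε
  obtain ⟨S, hS, hz⟩ := h (ε / 2) (half_pos hε)
  -- Following J by the projection onto S has finite rank and is within ε/2 of J, since the
  -- projection is the best approximation in S; compact operators are closed in norm.
  refine ⟨S.starProjection.comp J, ?_, ?_⟩
  · have : ProperSpace S := FiniteDimensional.proper ℝ S
    have hS : IsCompactOperator (S.subtypeL : S → E) :=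
      isCompactOperator_of_locallyCompactSpace_rng S.subtypeL
    exact hS.comp_clm (S.orthogonalProjectionOnto.comp J)
  · rw [dist_eq_norm]
    refine lt_of_le_of_lt (ContinuousLinearMap.opNorm_le_bound _ (half_pos hε).le fun z => ?_)
      (half_lt_self hε)
    obtain ⟨y, hy, hle⟩ := hz z
    refine le_trans ?_ hle
    change ‖J z - S.starProjection (J z)‖ ≤ _
    rw [Submodule.starProjection_minimal]
    exact ciInf_le ⟨0, by rintro _ ⟨x, rfl⟩; exact norm_nonneg _⟩ (⟨y, hy⟩ : S)

theorem norm_snd_le_of_submodule_prod {E F : Type*} [NormedAddCommGroup E] [InnerProductSpace ℝ E]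
    [NormedAddCommGroup F] [InnerProductSpace ℝ F] {G : Submodule ℝ (WithLp 2 (E × F))} (z : G) :
    ‖z.1.snd‖ ≤ ‖z‖ := by
  rw [Submodule.coe_norm]
  refine le_of_sq_le_sq ?_ (norm_nonneg _)
  rw [WithLp.prod_norm_sq_eq_of_L2 z.1]
  exact le_add_of_nonneg_left (sq_nonneg _)

theorem norm_le_of_enorm_sq_le {E F : Type*} [SeminormedAddCommGroup E] [SeminormedAddCommGroup F]
    {ε : ℝ} (hε : 0 ≤ ε) {w : E} {q : F} (h : ‖w‖ₑ ^ 2 ≤ ENNReal.ofReal (ε ^ 2) * ‖q‖ₑ ^ 2) :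
    ‖w‖ ≤ ε * ‖q‖ := by
  have h3 : ENNReal.ofReal (‖w‖ ^ 2) ≤ ENNReal.ofReal (ε ^ 2 * ‖q‖ ^ 2) := by
    rw [ENNReal.ofReal_pow (norm_nonneg _), ofReal_norm, ENNReal.ofReal_mul (by positivity),
      ENNReal.ofReal_pow (norm_nonneg _), ofReal_norm]
    exact h
  rw [ENNReal.ofReal_le_ofReal_iff (by positivity), ← mul_pow] at h3
  exact le_of_sq_le_sq h3 (by positivity)

theorem enorm_sq_eq_lintegral {α : Type*} [MeasurableSpace α] {μ : Measure α} (f : Lp ℝ 2 μ) :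
    ‖f‖ₑ ^ 2 = ∫⁻ x, ‖f x‖ₑ ^ 2 ∂μ := by
  rw [Lp.enorm_def, eLpNorm_eq_lintegral_rpow_enorm_toReal two_ne_zero ENNReal.ofNat_ne_top,
    ← ENNReal.rpow_natCast, ← ENNReal.rpow_mul]
  norm_num

variable {n : ℕ}

/-- The denominator of the squared quotient is at most d^(n+2s); on the diagonal the left side is
zero. -/
theorem enorm_sub_sq_le {s d : ℝ} (hs : 0 < s) (u : Space n → ℝ) (z : Space n × Space n)
    (hz : ‖z.1 - z.2‖ ≤ d) :
    ‖u z.1 - u z.2‖ₑ ^ 2 ≤ ENNReal.ofReal (d ^ ((n : ℝ) + 2 * s)) * ‖diffQuot s u z‖ₑ ^ 2 := by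
  have hpos : 0 < (n : ℝ) + 2 * s := by positivity
  have hd : 0 ≤ d := (norm_nonneg _).trans hz
  rw [Real.enorm_eq_ofReal_abs, Real.enorm_eq_ofReal_abs, ← ENNReal.ofReal_pow (abs_nonneg _),
    ← ENNReal.ofReal_pow (abs_nonneg _), ← ENNReal.ofReal_mul (by positivity), sq_abs, sq_abs]
  refine ENNReal.ofReal_le_ofReal ?_
  rw [sq (diffQuot s u z), diffQuot_mul, ← sq]
  by_cases h : z.1 = z.2
  · simp [h]
  · have h1 : 0 < ‖z.1 - z.2‖ := norm_pos_iff.2 (sub_ne_zero.2 h)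
    have h2 := Real.rpow_le_rpow h1.le hz hpos.le
    have h3 : 0 < ‖z.1 - z.2‖ ^ ((n : ℝ) + 2 * s) := by positivity
    rw [← mul_div_assoc, le_div_iff₀ h3, mul_comm]
    exact mul_le_mul_of_nonneg_right h2 (sq_nonneg _)

/-- On a set of small diameter, a function is close to a constant in `L²`, as measured by its
fractional difference quotient. -/
theorem exists_setLIntegral_sub_const_le {s d : ℝ} (hs : 0 < s) {u : Space n → ℝ}
    (hu : AEMeasurable u volume) {Q : Set (Space n)} (hQ : MeasurableSet Q) (hQ0 : volume Q ≠ 0)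
    (hQt : volume Q ≠ ∞) (hd : ∀ x ∈ Q, ∀ y ∈ Q, ‖x - y‖ ≤ d) :
    ∃ a : ℝ, ∫⁻ x in Q, ‖u x - a‖ₑ ^ 2 ≤ ENNReal.ofReal (d ^ ((n : ℝ) + 2 * s)) / volume Q *
      ∫⁻ z in Q ×ˢ Q, ‖diffQuot s u z‖ₑ ^ 2 := by
  have h1 : AEMeasurable (fun z : Space n × Space n => u z.1) (volume.prod volume) :=
    hu.comp_quasiMeasurePreserving Measure.quasiMeasurePreserving_fst
  have h2 : AEMeasurable (fun z : Space n × Space n => u z.2) (volume.prod volume) :=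
    hu.comp_quasiMeasurePreserving Measure.quasiMeasurePreserving_snd
  have hm : AEMeasurable (fun z : Space n × Space n => ‖u z.1 - u z.2‖ₑ ^ 2)
      (volume.prod volume) := (h1.sub h2).enorm.pow_const 2
  have hm' : AEMeasurable (fun z : Space n × Space n => ‖u z.1 - u z.2‖ₑ ^ 2)
      ((volume.restrict Q).prod (volume.restrict Q)) := by
    rw [Measure.prod_restrict]
    exact hm.restrict
  -- The constant is a value u(y) at a point where the inner integral does not exceed its average
  -- over Q; this replaces the mean of u.
  obtain ⟨y, -, hle⟩ := exists_le_setLAverage (f := fun y => ∫⁻ x in Q, ‖u x - u y‖ₑ ^ 2) hQ0 hQt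
    (by
      have := hm'.prod_swap.lintegral_prod_right'
      exact this)
  refine ⟨u y, hle.trans ?_⟩
  rw [setLAverage_eq, ← lintegral_prod_symm _ hm', Measure.prod_restrict,
    ← ENNReal.mul_div_right_comm, ← lintegral_const_mul' _ _ ENNReal.ofReal_ne_top]
  refine ENNReal.div_le_div_right (setLIntegral_mono' (hQ.prod hQ) fun z hz => ?_) _
  exact enorm_sub_sq_le hs u z (hd _ hz.1 _ hz.2)

/-- The half-open cube of side `δ` of the grid `δ ℤⁿ` with index `k`. -/
def gridCube (δ : ℝ) (k : Fin n → ℤ) : Set (Space n) :=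
  {x | ∀ i, x i ∈ Ico (k i * δ) ((k i + 1) * δ)}

theorem mem_gridCube_iff {δ : ℝ} (hδ : 0 < δ) {k : Fin n → ℤ} {x : Space n} :
    x ∈ gridCube δ k ↔ (fun i => ⌊x i / δ⌋) = k := by
  rw [funext_iff]
  refine forall_congr' fun i => ?_
  rw [Int.floor_eq_iff, mem_Ico, le_div_iff₀ hδ, div_lt_iff₀ hδ]

theorem gridCube_eq_preimage (δ : ℝ) (k : Fin n → ℤ) :
    gridCube δ k = (MeasurableEquiv.toLp 2 (Fin n → ℝ)).symm ⁻¹'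
      (univ.pi fun i => Ico (k i * δ) ((k i + 1) * δ)) := by
  ext x
  simp [gridCube]

theorem measurableSet_gridCube (δ : ℝ) (k : Fin n → ℤ) : MeasurableSet (gridCube δ k) := by
  rw [gridCube_eq_preimage]
  exact (MeasurableEquiv.measurable _) (MeasurableSet.univ_pi fun i => measurableSet_Ico)

theorem volume_gridCube {δ : ℝ} (hδ : 0 < δ) (k : Fin n → ℤ) :
    volume (gridCube δ k) = ENNReal.ofReal (δ ^ n) := by
  rw [gridCube_eq_preimage, (EuclideanSpace.volume_preserving_symm_measurableEquiv_toLp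
    (Fin n)).measure_preimage (MeasurableSet.univ_pi fun i => measurableSet_Ico).nullMeasurableSet,
    Real.volume_pi_Ico]
  have : ∀ i, ((k i : ℝ) + 1) * δ - k i * δ = δ := fun i => by ring
  simp_rw [this]
  rw [Finset.prod_const, Finset.card_univ, Fintype.card_fin, ENNReal.ofReal_pow hδ.le]

theorem norm_sub_le_of_mem_gridCube {δ : ℝ} (hδ : 0 < δ) {k : Fin n → ℤ} {x y : Space n}
    (hx : x ∈ gridCube δ k) (hy : y ∈ gridCube δ k) : ‖x - y‖ ≤ √n * δ := by
  rw [EuclideanSpace.norm_eq, Real.sqrt_le_left (by positivity), mul_pow,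
    Real.sq_sqrt (Nat.cast_nonneg n)]
  have : ∀ i ∈ Finset.univ, ‖(x - y) i‖ ^ 2 ≤ δ ^ 2 := fun i _ => by
    rw [PiLp.sub_apply, Real.norm_eq_abs, sq_abs]
    have h1 := hx i
    have h2 := hy i
    rw [mem_Ico] at h1 h2
    refine sq_le_sq' ?_ ?_ <;> linarith
  simpa using Finset.sum_le_sum this

theorem exists_finset_gridCube {δ : ℝ} (hδ : 0 < δ) {Ω : Set (Space n)}
    (hΩ : Bornology.IsBounded Ω) :
    ∃ F : Finset (Fin n → ℤ), Ω ⊆ ⋃ k ∈ F, gridCube δ k := by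
  obtain ⟨R, hR⟩ := hΩ.exists_norm_le
  refine ⟨Fintype.piFinset fun _ => Finset.Icc ⌊-R / δ⌋ ⌊R / δ⌋, fun x hx => ?_⟩
  refine mem_iUnion₂.2 ⟨fun i => ⌊x i / δ⌋, ?_, (mem_gridCube_iff hδ).2 rfl⟩
  rw [Fintype.mem_piFinset]
  intro i
  have h1 := abs_le.1 ((PiLp.norm_apply_le x i).trans (hR x hx))
  rw [Finset.mem_Icc]
  constructor <;> refine Int.floor_le_floor ?_ <;> gcongr
  exacts [h1.1, h1.2]

/-- A function in `L²(Ω)` with square integrable difference quotient is close to a step function. -/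
theorem exists_step_approx {s : ℝ} (hs : 0 < s) {Ω : Set (Space n)} (hΩ : MeasurableSet Ω)
    {δ : ℝ} (hδ : 0 < δ) {F : Finset (Fin n → ℤ)} (hF : Ω ⊆ ⋃ k ∈ F, gridCube δ k)
    (ind : (Fin n → ℤ) → L2 Ω)
    (hind : ∀ k, ind k =ᵐ[volume.restrict Ω] (gridCube δ k).indicator fun _ => 1) (u : L2 Ω) :
    ∃ y ∈ Submodule.span ℝ (ind '' F), ‖u - y‖ₑ ^ 2 ≤
      ENNReal.ofReal ((√n * δ) ^ ((n : ℝ) + 2 * s)) / ENNReal.ofReal (δ ^ n) *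
        ∫⁻ z, ‖diffQuot s (zeroExt Ω u) z‖ₑ ^ 2 := by
  have hvol : ∀ k : Fin n → ℤ, volume (gridCube δ k) ≠ 0 := fun k => by
    rw [volume_gridCube hδ]
    simpa using pow_pos hδ n
  have hvol' : ∀ k : Fin n → ℤ, volume (gridCube δ k) ≠ ∞ := fun k => by
    rw [volume_gridCube hδ]
    exact ENNReal.ofReal_ne_top
  choose a ha using fun k => exists_setLIntegral_sub_const_le hs (aemeasurable_zeroExt hΩ u)
    (measurableSet_gridCube δ k) (hvol k) (hvol' k)
    (fun x hx y hy => norm_sub_le_of_mem_gridCube hδ hx hy)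
  have hdisj : ∀ k l : Fin n → ℤ, k ≠ l → Disjoint (gridCube δ k) (gridCube δ l) := fun k l hkl =>
    Set.disjoint_left.2 fun x hx hx' => hkl <|
      ((mem_gridCube_iff hδ).1 hx).symm.trans ((mem_gridCube_iff hδ).1 hx')
  refine ⟨∑ k ∈ F, a k • ind k, Submodule.sum_mem _ fun k hk =>
    Submodule.smul_mem _ _ (Submodule.subset_span ⟨k, hk, rfl⟩), ?_⟩
  have hy : ∀ᵐ x ∂(volume.restrict Ω), (u - ∑ k ∈ F, a k • ind k : L2 Ω) x
      = zeroExt Ω u x - ∑ k ∈ F, a k * (gridCube δ k).indicator (fun _ => (1 : ℝ)) x := by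
    have h2 : ∀ᵐ x ∂(volume.restrict Ω), (∑ k ∈ F, a k • ind k : L2 Ω) x
        = ∑ k ∈ F, a k * (gridCube δ k).indicator (fun _ => (1 : ℝ)) x := by
      clear hF
      induction F using Finset.induction_on with
      | empty => filter_upwards [Lp.coeFn_zero ℝ 2 (volume.restrict Ω)] with x hx; simpa using hx
      | insert k F hk ih =>
        rw [Finset.sum_insert hk]
        filter_upwards [ih, hind k, Lp.coeFn_smul (a k) (ind k),
          Lp.coeFn_add (a k • ind k) (∑ k ∈ F, a k • ind k)] with x h3 h4 h5 h6
        rw [h6, Pi.add_apply, h5, Pi.smul_apply, h4, h3, Finset.sum_insert hk, smul_eq_mul]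
    filter_upwards [h2, Lp.coeFn_sub u (∑ k ∈ F, a k • ind k), zeroExt_ae_eq_restrict hΩ u]
      with x h1 h3 h4
    rw [h3, Pi.sub_apply, h1, h4]
  rw [enorm_sq_eq_lintegral]
  calc ∫⁻ x in Ω, ‖(u - ∑ k ∈ F, a k • ind k : L2 Ω) x‖ₑ ^ 2
      = ∫⁻ x in Ω, ‖zeroExt Ω u x
          - ∑ k ∈ F, a k * (gridCube δ k).indicator (fun _ => (1 : ℝ)) x‖ₑ ^ 2 := by
        refine lintegral_congr_ae ?_
        filter_upwards [hy] with x hx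
        rw [hx]
    -- The extension by zero allows whole cubes, so each has volume exactly δⁿ even when it sticks
    -- out of Ω.
    _ ≤ ∫⁻ x in ⋃ k ∈ F, gridCube δ k, ‖zeroExt Ω u x
          - ∑ k ∈ F, a k * (gridCube δ k).indicator (fun _ => (1 : ℝ)) x‖ₑ ^ 2 :=
        lintegral_mono_set hF
    _ = ∑ k ∈ F, ∫⁻ x in gridCube δ k, ‖zeroExt Ω u x
          - ∑ k ∈ F, a k * (gridCube δ k).indicator (fun _ => (1 : ℝ)) x‖ₑ ^ 2 :=
        lintegral_biUnion_finset (fun k _ l _ hkl => hdisj k l hkl)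
          (fun k _ => measurableSet_gridCube δ k) _
    _ = ∑ k ∈ F, ∫⁻ x in gridCube δ k, ‖zeroExt Ω u x - a k‖ₑ ^ 2 := by
        refine Finset.sum_congr rfl fun k hk => ?_
        refine setLIntegral_congr_fun (measurableSet_gridCube δ k) fun x hx => ?_
        rw [Finset.sum_eq_single_of_mem k hk fun l _ hl => by
          rw [indicator_of_notMem (Set.disjoint_right.1 (hdisj l k hl) hx), mul_zero],
          indicator_of_mem hx, mul_one]
    _ ≤ ∑ k ∈ F, ENNReal.ofReal ((√n * δ) ^ ((n : ℝ) + 2 * s)) / ENNReal.ofReal (δ ^ n) *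
          ∫⁻ z in gridCube δ k ×ˢ gridCube δ k, ‖diffQuot s (zeroExt Ω u) z‖ₑ ^ 2 := by
        refine Finset.sum_le_sum fun k _ => ?_
        rw [← volume_gridCube hδ k]
        exact ha k
    _ = ENNReal.ofReal ((√n * δ) ^ ((n : ℝ) + 2 * s)) / ENNReal.ofReal (δ ^ n) *
          ∫⁻ z in ⋃ k ∈ F, gridCube δ k ×ˢ gridCube δ k, ‖diffQuot s (zeroExt Ω u) z‖ₑ ^ 2 := by
        rw [← Finset.mul_sum, lintegral_biUnion_finset]
        · exact fun k _ l _ hkl => Set.disjoint_left.2 fun z hz hz' =>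
            Set.disjoint_left.1 (hdisj k l hkl) hz.1 hz'.1
        · exact fun k _ => (measurableSet_gridCube δ k).prod (measurableSet_gridCube δ k)
    _ ≤ _ := mul_le_mul_right (setLIntegral_le_lintegral _ _) _

/-- The constant (√n δ)^(n+2s) / δⁿ equals √n^(n+2s) δ^(2s), which tends to 0 with δ because s > 0.
-/
theorem exists_finiteDimensional_approx {s : ℝ} (hs : 0 < s) {Ω : Set (Space n)}
    (hΩ : MeasurableSet Ω) (hb : Bornology.IsBounded Ω) {ε : ℝ} (hε : 0 < ε) :
    ∃ S : Submodule ℝ (L2 Ω), FiniteDimensional ℝ S ∧ ∀ u : L2 Ω, ∃ y ∈ S, ‖u - y‖ₑ ^ 2 ≤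
      ENNReal.ofReal (ε ^ 2) * ∫⁻ z, ‖diffQuot s (zeroExt Ω u) z‖ₑ ^ 2 := by
  have hlim : Tendsto (fun δ : ℝ => √n ^ ((n : ℝ) + 2 * s) * δ ^ (2 * s)) (𝓝[>] 0) (𝓝 0) := by
    have : Tendsto (fun δ : ℝ => δ ^ (2 * s)) (𝓝[>] 0) (𝓝 (0 ^ (2 * s))) :=
      ((Real.continuousAt_rpow_const 0 (2 * s) (Or.inr (by positivity))).tendsto).mono_left
        nhdsWithin_le_nhds
    rw [Real.zero_rpow (by positivity)] at this
    simpa using this.const_mul (√n ^ ((n : ℝ) + 2 * s))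
  obtain ⟨δ, hδε, hδ⟩ := ((hlim.eventually (gt_mem_nhds (show (0 : ℝ) < ε ^ 2 by positivity))).and
    self_mem_nhdsWithin).exists
  have hδ : 0 < δ := hδ
  have hC : ENNReal.ofReal ((√n * δ) ^ ((n : ℝ) + 2 * s)) / ENNReal.ofReal (δ ^ n)
      ≤ ENNReal.ofReal (ε ^ 2) := by
    rw [← ENNReal.ofReal_div_of_pos (by positivity)]
    refine ENNReal.ofReal_le_ofReal (le_trans (le_of_eq ?_) hδε.le)
    rw [Real.mul_rpow (by positivity) hδ.le, Real.rpow_add hδ, Real.rpow_natCast]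
    field_simp
  obtain ⟨F, hF⟩ := exists_finset_gridCube hδ hb
  have hfin : ∀ k : Fin n → ℤ, (volume.restrict Ω) (gridCube δ k) ≠ ∞ := fun k =>
    ((Measure.restrict_apply_le _ _).trans_lt (by
      rw [volume_gridCube hδ]; exact ENNReal.ofReal_lt_top)).ne
  refine ⟨Submodule.span ℝ ((fun k => indicatorConstLp 2 (measurableSet_gridCube δ k) (hfin k)
    (1 : ℝ)) '' F), FiniteDimensional.span_of_finite ℝ (F.finite_toSet.image _), fun u => ?_⟩
  obtain ⟨y, hy, hle⟩ := exists_step_approx hs hΩ hδ hF _ (fun k => indicatorConstLp_coeFn) u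
  exact ⟨y, hy, hle.trans (mul_le_mul_left hC _)⟩

theorem lintegral_diffQuot_formProj {s : ℝ} {Ω : Set (Space n)} (hΩ : MeasurableSet Ω)
    (z : formGraph s hΩ) :
    ∫⁻ x, ‖diffQuot s (zeroExt Ω (formProj s hΩ z)) x‖ₑ ^ 2 = ‖z.1.snd‖ₑ ^ 2 := by
  rw [enorm_sq_eq_lintegral]
  refine lintegral_congr_ae ?_
  filter_upwards [mem_formGraph.1 z.2] with x hx
  rw [hx, formProj_apply]

/-- The embedding of `ℍ₀ˢ(Ω)` into `L²(Ω)` is compact for bounded `Ω`. -/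
theorem isCompactOperator_formProj {s : ℝ} (hs : 0 < s) {Ω : Set (Space n)} (hΩ : MeasurableSet Ω)
    (hb : Bornology.IsBounded Ω) : IsCompactOperator (formProj s hΩ) := by
  refine isCompactOperator_of_finiteDimensional_approx _ fun ε hε => ?_
  obtain ⟨S, hS, h⟩ := exists_finiteDimensional_approx hs hΩ hb hε
  refine ⟨S, hS, fun z => ?_⟩
  obtain ⟨y, hy, hle⟩ := h (formProj s hΩ z)
  refine ⟨y, hy, ?_⟩
  rw [lintegral_diffQuot_formProj] at hle
  exact (norm_le_of_enorm_sq_le hε.le hle).trans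
    (mul_le_mul_of_nonneg_left (norm_snd_le_of_submodule_prod z) hε.le)

end Compactness

/-! ### Density of the form domain and infinite dimension of L²(Ω). -/

section Density

open scoped InnerProductSpace ContDiff

variable {n : ℕ}

theorem nontrivial_space (hn : 0 < n) : Nontrivial (Space n) := by
  have : NeZero n := ⟨hn.ne'⟩
  infer_instance

/-- The radial majorant of squared difference quotients of bounded Lipschitz functions is
integrable. -/
theorem integrable_radial_majorant (hn : 0 < n) {s : ℝ} (hs0 : 0 < s) (hs1 : s < 1) {A B : ℝ}
    (hA : 0 ≤ A) (hB : 0 ≤ B) :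
    Integrable (fun w : Space n => min (A * ‖w‖ ^ 2) B / ‖w‖ ^ ((n : ℝ) + 2 * s)) volume := by
  have := nontrivial_space hn
  rw [integrable_fun_norm_addHaar (volume : Measure (Space n))
    (f := fun r : ℝ => min (A * r ^ 2) B / r ^ ((n : ℝ) + 2 * s)), ← Ioc_union_Ioi_eq_Ioi
    (zero_le_one (α := ℝ)), finrank_euclideanSpace, Fintype.card_fin]
  have hmeas : Measurable fun r : ℝ =>
      r ^ (n - 1) • (min (A * r ^ 2) B / r ^ ((n : ℝ) + 2 * s)) := by fun_prop
  have hpow : ∀ r : ℝ, 0 < r → r ^ (n - 1) / r ^ ((n : ℝ) + 2 * s) = r ^ (-1 - 2 * s) := by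
    intro r hr
    rw [← Real.rpow_natCast, ← Real.rpow_sub hr, Nat.cast_pred hn]
    congr 1
    ring
  have hnorm : ∀ r : ℝ, 0 < r → ‖r ^ (n - 1) • (min (A * r ^ 2) B / r ^ ((n : ℝ) + 2 * s))‖
      = min (A * r ^ 2) B * r ^ (-1 - 2 * s) := by
    intro r hr
    rw [Real.norm_of_nonneg (by positivity), smul_eq_mul, ← hpow r hr]
    ring
  -- In polar coordinates the integrand is at most A r^(1-2s) near 0, integrable as s < 1, and B
  -- r^(-1-2s) at infinity, integrable as s > 0.
  refine IntegrableOn.union ?_ ?_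
  · have h1 : IntegrableOn (fun r : ℝ => A * r ^ (1 - 2 * s)) (Ioc 0 1) := by
      refine Integrable.const_mul ?_ A
      exact (intervalIntegrable_iff_integrableOn_Ioc_of_le zero_le_one).1
        (intervalIntegral.intervalIntegrable_rpow' (by linarith))
    refine Integrable.mono' h1 hmeas.aestronglyMeasurable ?_
    filter_upwards [ae_restrict_mem measurableSet_Ioc] with r hr
    have hr0 : 0 < r := hr.1
    rw [hnorm r hr0]
    calc min (A * r ^ 2) B * r ^ (-1 - 2 * s) ≤ (A * r ^ 2) * r ^ (-1 - 2 * s) := by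
          gcongr
          exact min_le_left _ _
      _ = A * r ^ (1 - 2 * s) := by
          rw [mul_assoc, ← Real.rpow_natCast, ← Real.rpow_add hr0]
          congr 2
          push_cast
          ring
  · have h1 : IntegrableOn (fun r : ℝ => B * r ^ (-1 - 2 * s)) (Ioi 1) :=
      (integrableOn_Ioi_rpow_of_lt (by linarith) one_pos).const_mul B
    refine Integrable.mono' h1 hmeas.aestronglyMeasurable ?_
    filter_upwards [ae_restrict_mem measurableSet_Ioi] with r hr
    have hr0 : 0 < r := one_pos.trans hr
    rw [hnorm r hr0]
    gcongr
    exact min_le_right _ _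

/-- Compactly supported smooth functions have square integrable difference quotients. -/
theorem memLp_diffQuot_of_contDiff (hn : 0 < n) {s : ℝ} (hs0 : 0 < s) (hs1 : s < 1)
    {g : Space n → ℝ} (hg : ContDiff ℝ ∞ g) (hgc : HasCompactSupport g) :
    MemLp (diffQuot s g) 2 volume := by
  have hms : AEStronglyMeasurable (diffQuot s g) volume :=
    aestronglyMeasurable_diffQuot s hg.continuous.measurable.aemeasurable
  rw [memLp_two_iff_integrable_sq hms]
  obtain ⟨L, hL⟩ := hg.lipschitzWith_of_hasCompactSupport hgc (by simp)
  obtain ⟨M, hM⟩ := hg.continuous.bounded_above_of_compact_support hgc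
  have hM0 : 0 ≤ M := (norm_nonneg _).trans (hM 0)
  -- The Lipschitz bound and the sup bound give |diffQuot|² ≤ h(x - y), and the quotient vanishes
  -- unless x or y is in the support K. So (1_K(x) + 1_K(y)) h(x - y) is a majorant, integrable as a
  -- sum of convolution integrands.
  set h : Space n → ℝ := fun w =>
    min ((L : ℝ) ^ 2 * ‖w‖ ^ 2) ((2 * M) ^ 2) / ‖w‖ ^ ((n : ℝ) + 2 * s) with hh
  have hint : Integrable h volume :=
    integrable_radial_majorant hn hs0 hs1 (by positivity) (by positivity)
  set K := tsupport g
  have hK : Integrable (K.indicator fun _ => (1 : ℝ)) (volume : Measure (Space n)) :=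
    (integrable_indicator_iff (isClosed_tsupport g).measurableSet).2
      (integrableOn_const (hgc.isCompact.measure_lt_top.ne))
  have h2 : Integrable (fun z : Space n × Space n => K.indicator (fun _ => (1 : ℝ)) z.2
      * h (z.1 - z.2)) volume :=
    hK.convolution_integrand (ContinuousLinearMap.mul ℝ ℝ) hint
  have h1 : Integrable (fun z : Space n × Space n => K.indicator (fun _ => (1 : ℝ)) z.1
      * h (z.2 - z.1)) volume := h2.swap
  refine (h1.add h2).mono' (hms.pow 2) (Eventually.of_forall fun z => ?_)
  have hsymm : h (z.2 - z.1) = h (z.1 - z.2) := by rw [hh]; simp only [norm_sub_rev z.2 z.1]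
  have hnn : 0 ≤ h (z.1 - z.2) := by positivity
  rw [Pi.add_apply, hsymm, Real.norm_of_nonneg (sq_nonneg _), ← add_mul]
  by_cases hz : z.1 ∈ K ∨ z.2 ∈ K
  · have hone : 1 ≤ K.indicator (fun _ => (1 : ℝ)) z.1 + K.indicator (fun _ => (1 : ℝ)) z.2 := by
      have hnn' : ∀ x, 0 ≤ K.indicator (fun _ => (1 : ℝ)) x :=
        fun x => indicator_nonneg (fun _ _ => zero_le_one) x
      rcases hz with hz | hz
      · rw [indicator_of_mem hz]
        linarith [hnn' z.2]
      · rw [indicator_of_mem hz]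
        linarith [hnn' z.1]
    refine le_trans ?_ (le_mul_of_one_le_left hnn hone)
    rw [sq, diffQuot_mul, ← sq, hh]
    refine div_le_div_of_nonneg_right (le_min ?_ ?_) (by positivity)
    · have := hL.dist_le_mul z.1 z.2
      rw [dist_eq_norm, dist_eq_norm, Real.norm_eq_abs] at this
      rw [← mul_pow, ← sq_abs]
      gcongr
    · have h3 := hM z.1
      have h4 := hM z.2
      rw [Real.norm_eq_abs, abs_le] at h3 h4
      exact sq_le_sq' (by linarith) (by linarith)
  · rw [not_or] at hz
    rw [diffQuot, image_eq_zero_of_notMem_tsupport hz.1, image_eq_zero_of_notMem_tsupport hz.2]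
    simp only [sub_zero, zero_div, ne_eq, OfNat.ofNat_ne_zero, not_false_eq_true, zero_pow]
    exact mul_nonneg (add_nonneg (indicator_nonneg (fun _ _ => zero_le_one) _)
      (indicator_nonneg (fun _ _ => zero_le_one) _)) hnn

/-- `ℍ₀ˢ(Ω)` is dense in `L²(Ω)`. -/
theorem eq_zero_of_forall_inner_formProj (hn : 0 < n) {s : ℝ} (hs0 : 0 < s) (hs1 : s < 1)
    {Ω : Set (Space n)} (hΩ : IsOpen Ω) (x : L2 Ω)
    (hx : ∀ z, ⟪x, formProj s hΩ.measurableSet z⟫_ℝ = 0) : x = 0 := by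
  have hm := hΩ.measurableSet
  have hL : MemLp (zeroExt Ω x) 2 volume := (memLp_indicator_iff_restrict hm).2 (Lp.memLp x)
  -- Test functions supported in Ω lie in ℍ₀ˢ(Ω), so x annihilates all of them.
  have hzero := hΩ.ae_eq_zero_of_integral_contDiff_smul_eq_zero (μ := volume)
    ((hL.locallyIntegrable one_le_two).locallyIntegrableOn Ω) fun g hg hgc hgs => by
      have hgL : MemLp g 2 (volume.restrict Ω) := (hg.continuous.memLp_of_hasCompactSupport hgc)
      have hgH : MemH0s s Ω g :=
        { memHs := ⟨hg.continuous.measurable.aemeasurable, hgL,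
            (memLp_diffQuot_of_contDiff hn hs0 hs1 hg hgc).restrict _⟩
          ae_eq_zero := by
            filter_upwards [ae_restrict_mem hm.compl] with y hy
            exact image_eq_zero_of_notMem_tsupport fun h => hy (hgs h) }
      obtain ⟨z, hz⟩ := exists_formProj_eq hm (hgH.zeroExt_toLp hm)
      have := hx z
      rw [hz] at this
      rw [← integral_mul_toLp x hgL] at this
      rw [← this, ← integral_indicator hm]
      refine integral_congr_ae (Eventually.of_forall fun y => ?_)
      by_cases hy : y ∈ Ω
      · simp [zeroExt, hy, mul_comm]
      · simp [zeroExt, hy]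
  refine (Lp.eq_zero_iff_ae_eq_zero).2 ?_
  rw [Filter.EventuallyEq, ae_restrict_iff' hm]
  filter_upwards [hzero] with y hy hyΩ
  simpa [zeroExt, hyΩ] using hy hyΩ

/-- `L²(Ω)` is infinite dimensional for nonempty open `Ω`. -/
theorem not_finiteDimensional_L2 (hn : 0 < n) {Ω : Set (Space n)} (hΩ : IsOpen Ω)
    (hne : Ω.Nonempty) (hb : Bornology.IsBounded Ω) : ¬ FiniteDimensional ℝ (L2 Ω) := by
  intro hfin
  have := nontrivial_space hn
  obtain ⟨x, hx⟩ := hne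
  have : Infinite Ω := (infinite_of_mem_nhds x (hΩ.mem_nhds hx)).to_subtype
  -- Indicators of infinitely many disjoint nonempty open subsets of Ω are nonzero and mutually
  -- orthogonal, hence independent.
  obtain ⟨U, hUinf, hUo, hUd⟩ := exists_seq_infinite_isOpen_pairwise_disjoint Ω
  set W : ℕ → Set (Space n) := fun k => Subtype.val '' U k
  have hWo : ∀ k, IsOpen (W k) := fun k => hΩ.isOpenMap_subtype_val _ (hUo k)
  have hWΩ : ∀ k, W k ⊆ Ω := fun k => Subtype.coe_image_subset _ _
  have hWd : ∀ i j, i ≠ j → Disjoint (W i) (W j) := fun i j hij =>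
    (disjoint_image_iff Subtype.val_injective).2 (hUd hij)
  have hWfin : ∀ k, (volume.restrict Ω) (W k) ≠ ⊤ := fun k =>
    ((Measure.restrict_apply_le _ _).trans_lt (hb.subset (hWΩ k)).measure_lt_top).ne
  have hWpos : ∀ k, (volume.restrict Ω) (W k) ≠ 0 := fun k => by
    rw [Measure.restrict_apply (hWo k).measurableSet, inter_eq_left.2 (hWΩ k)]
    exact ((hWo k).measure_pos volume ((hUinf k).nonempty.image _)).ne'
  set ind : ℕ → L2 Ω := fun k => indicatorConstLp 2 (hWo k).measurableSet (hWfin k) (1 : ℝ)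
  have hlin : LinearIndependent ℝ ind := by
    refine linearIndependent_of_ne_zero_of_inner_eq_zero (fun k h => ?_) fun i j hij => ?_
    · have h1 : ⟪ind k, ind k⟫_ℝ = (volume.restrict Ω).real (W k) := by
        rw [L2.inner_indicatorConstLp_one (hWo k).measurableSet (hWfin k),
          setIntegral_congr_ae (g := fun _ => (1 : ℝ)) (hWo k).measurableSet]
        · simp
        · filter_upwards [indicatorConstLp_coeFn (p := 2) (hs := (hWo k).measurableSet)
            (hμs := hWfin k) (c := (1 : ℝ))] with y hy hyW
          rw [hy, indicator_of_mem hyW]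
      rw [h, inner_zero_left] at h1
      exact (ENNReal.toReal_pos (hWpos k) (hWfin k)).ne h1
    · change ⟪ind i, ind j⟫_ℝ = 0
      rw [L2.inner_indicatorConstLp_one (hWo i).measurableSet (hWfin i),
        setIntegral_congr_ae (g := fun _ => (0 : ℝ)) (hWo i).measurableSet]
      · simp
      · filter_upwards [indicatorConstLp_coeFn (p := 2) (hs := (hWo j).measurableSet)
          (hμs := hWfin j) (c := (1 : ℝ))] with y hy hyW
        rw [hy, indicator_of_notMem (Set.disjoint_left.1 (hWd i j hij) hyW)]
  exact not_finite_iff_infinite.2 inferInstance hlin.finite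

end Density

/-! ### Eigenfunctions of the fractional Laplacian and weak solutions. -/

section Main

open scoped InnerProductSpace

variable {n : ℕ} {s : ℝ} {Ω : Set (Space n)}

/-- The weak eigenvalue equation may be tested with elements of `L²(Ω)` only. -/
theorem isEigenpair_iff_forall_L2 (hΩ : MeasurableSet Ω) {μ : ℝ} {w : L2 Ω} :
    IsEigenpair s Ω μ w ↔ w ≠ 0 ∧ MemH0s s Ω (zeroExt Ω w) ∧ ∀ v : L2 Ω, MemH0s s Ω (zeroExt Ω v) →
      innerH0s s (zeroExt Ω w) (zeroExt Ω v) = μ * ⟪w, v⟫_ℝ := by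
  refine ⟨fun h => ⟨h.ne_zero, h.memH0s, fun v hv => ?_⟩, fun h => ⟨h.1, h.2.1, fun v hv => ?_⟩⟩
  · rw [h.weak_eq _ hv, integral_mul_zeroExt hΩ]
  · rw [integral_mul_toLp w hv.memHs.memLp, ← h.2.2 _ (hv.zeroExt_toLp hΩ)]
    exact innerH0s_congr s EventuallyEq.rfl (hv.congr_zeroExt hΩ).symm

theorem IsEigenpair.nonneg (hΩ : MeasurableSet Ω) {μ : ℝ} {w : L2 Ω} (h : IsEigenpair s Ω μ w) :
    0 ≤ μ := by
  have h1 := ((isEigenpair_iff_forall_L2 hΩ).1 h).2.2 w h.memH0s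
  have h2 := innerH0s_self_nonneg s (zeroExt Ω w)
  rw [h1, real_inner_self_eq_norm_sq] at h2
  have h3 : 0 < ‖w‖ := norm_pos_iff.2 h.ne_zero
  exact nonneg_of_mul_nonneg_left h2 (by positivity)

/-- `T` is the resolvent `(1 + (-Δ)ˢ)⁻¹` of the Dirichlet fractional Laplacian. -/
structure IsResolvent (s : ℝ) (Ω : Set (Space n)) (T : L2 Ω →L[ℝ] L2 Ω) : Prop where
  compact : IsCompactOperator T
  symm : T.toLinearMap.IsSymmetric
  pos : ∀ x, x ≠ 0 → 0 < ⟪T x, x⟫_ℝ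
  memH0s : ∀ x, MemH0s s Ω (zeroExt Ω (T x))
  eq_iff : ∀ u x : L2 Ω, MemH0s s Ω (zeroExt Ω u) → (u = T x ↔ ∀ v : L2 Ω,
    MemH0s s Ω (zeroExt Ω v) → innerH0s s (zeroExt Ω u) (zeroExt Ω v) + ⟪u, v⟫_ℝ = ⟪x, v⟫_ℝ)

variable {T : L2 Ω →L[ℝ] L2 Ω}

theorem IsResolvent.innerH0s_apply (hT : IsResolvent s Ω T) (x : L2 Ω) {v : L2 Ω}
    (hv : MemH0s s Ω (zeroExt Ω v)) :
    innerH0s s (zeroExt Ω (T x)) (zeroExt Ω v) = ⟪x - T x, v⟫_ℝ := by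
  have := (hT.eq_iff (T x) x (hT.memH0s x)).1 rfl v hv
  rw [inner_sub_left]
  linarith

/-- (1 + A)w = (1 + μ)w. Together with `IsResolvent.isEigenpair` this is the order-reversing
correspondence μ ↔ 1/(1+μ) between the two spectra. -/
theorem IsEigenpair.apply_resolvent (hT : IsResolvent s Ω T) (hΩ : MeasurableSet Ω) {μ : ℝ}
    {w : L2 Ω} (h : IsEigenpair s Ω μ w) : T w = (1 + μ)⁻¹ • w := by
  have hμ : (1 + μ) ≠ 0 := by linarith [h.nonneg hΩ]
  have h1 : w = T ((1 + μ) • w) := (hT.eq_iff w _ h.memH0s).2 fun v hv => by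
    rw [((isEigenpair_iff_forall_L2 hΩ).1 h).2.2 v hv, inner_smul_left]
    simp only [conj_trivial]
    ring
  rw [map_smul] at h1
  conv_rhs => rw [h1]
  rw [smul_smul, inv_mul_cancel₀ hμ, one_smul]

theorem IsResolvent.isEigenpair (hT : IsResolvent s Ω T) (hΩ : MeasurableSet Ω) {c : ℝ} (hc : 0 < c)
    {w : L2 Ω} (hw0 : w ≠ 0) (hw : T w = c • w) : IsEigenpair s Ω (c⁻¹ - 1) w := by
  have h1 : w = T (c⁻¹ • w) := by
    rw [map_smul, hw, smul_smul, inv_mul_cancel₀ hc.ne', one_smul]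
  refine (isEigenpair_iff_forall_L2 hΩ).2 ⟨hw0, ?_, fun v hv => ?_⟩
  · rw [h1]
    exact hT.memH0s _
  · have h2 := hT.innerH0s_apply (c⁻¹ • w) hv
    rw [← h1] at h2
    rw [h2, inner_sub_left, inner_smul_left]
    simp only [conj_trivial]
    ring

theorem exists_isResolvent (hn : 0 < n) (hs : s ∈ Ioo (0 : ℝ) 1) (hΩ : IsOpen Ω)
    (hb : Bornology.IsBounded Ω) : ∃ T, IsResolvent s Ω T := by
  obtain ⟨T, h1, h2, h3, h4, h5⟩ := exists_resolvent hΩ.measurableSet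
    (isCompactOperator_formProj hs.1 hΩ.measurableSet hb)
    (eq_zero_of_forall_inner_formProj hn hs.1 hs.2 hΩ)
  exact ⟨T, h1, h2, h3, h4, h5⟩

theorem IsResolvent.exists_isEigensystem (hT : IsResolvent s Ω T) (hΩ : MeasurableSet Ω)
    (hinf : ¬ FiniteDimensional ℝ (L2 Ω)) :
    ∃ (lam : ℕ → ℝ) (e : ℕ → L2 Ω), IsEigensystem s Ω lam e := by
  obtain ⟨κ, e, he, hκ, hTe, hanti, hex⟩ :=
    exists_orthonormal_eigenvectors hT.compact hT.symm hT.pos hinf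
  refine ⟨fun k => (κ k)⁻¹ - 1, e, fun k => hT.isEigenpair hΩ (hκ k) (he.ne_zero k) (hTe k), he,
    fun i j hij => sub_le_sub_right (inv_anti₀ (hκ j) (hanti hij)) 1, fun μ w hw => ?_⟩
  have hμ : 0 < 1 + μ := by linarith [hw.nonneg hΩ]
  refine Submodule.span_mono (image_mono fun k hk => ?_)
    (hex _ w (inv_pos.2 hμ) (hw.apply_resolvent hT hΩ))
  rw [mem_ofPred_eq] at hk ⊢
  rw [hk, inv_inv]
  ring

/-- The eigenfunctions form a Hilbert basis of `L²(Ω)`. -/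
theorem IsEigensystem.exists_hilbertBasis (hT : IsResolvent s Ω T) (hΩ : MeasurableSet Ω)
    {lam : ℕ → ℝ} {e : ℕ → L2 Ω} (h : IsEigensystem s Ω lam e) :
    ∃ b : HilbertBasis ℕ ℝ (L2 Ω), ∀ k, b k = e k := by
  -- Completeness follows from exhaustion: every eigenvector of the resolvent is an eigenfunction,
  -- hence a combination of the listed ones.
  have hspan : (Submodule.span ℝ (range e))ᗮ = ⊥ :=
    orthogonal_span_eq_bot hT.compact hT.symm hT.pos fun c w hc hw0 hw =>
      Submodule.span_mono (image_subset_range _ _)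
        (h.exhausts _ w (hT.isEigenpair hΩ hc hw0 hw))
  exact ⟨HilbertBasis.mkOfOrthogonalEqBot h.orthonormal hspan, fun k => by
    rw [HilbertBasis.coe_mkOfOrthogonalEqBot]⟩

/-- Elements of the operator domain belong to `ℍ₀ˢ(Ω)`, and the scalar product is given by the
operator. -/
theorem IsResolvent.mem_domain (hT : IsResolvent s Ω T) (hΩ : MeasurableSet Ω) {lam : ℕ → ℝ}
    {b : HilbertBasis ℕ ℝ (L2 Ω)} (h : ∀ k, IsEigenpair s Ω (lam k) (b k)) {u z : L2 Ω}
    (hz : ∀ k, ⟪b k, z⟫_ℝ = lam k * ⟪b k, u⟫_ℝ) :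
    MemH0s s Ω (zeroExt Ω u) ∧ ∀ v : L2 Ω, MemH0s s Ω (zeroExt Ω v) →
      innerH0s s (zeroExt Ω u) (zeroExt Ω v) = ⟪z, v⟫_ℝ := by
  -- Here z plays the role of Au: z + u has coefficients (1 + λ_k) u_k, which T divides by 1 + λ_k.
  have hu : u = T (z + u) := ext_coeff b fun k => by
    have h1 := hT.symm (b k) (z + u)
    simp only [ContinuousLinearMap.coe_coe] at h1
    have hpos : (1 + lam k) ≠ 0 := by linarith [(h k).nonneg hΩ]
    rw [← h1, (h k).apply_resolvent hT hΩ, inner_smul_left, inner_add_right, hz]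
    simp only [conj_trivial]
    field_simp
    ring
  refine ⟨by rw [hu]; exact hT.memH0s _, fun v hv => ?_⟩
  have h2 := hT.innerH0s_apply (z + u) hv
  rwa [← hu, add_sub_cancel_right] at h2

theorem contDiffOn_one_of_hasDerivWithinAt {E : Type*} [NormedAddCommGroup E] [NormedSpace ℝ E]
    {A : Set ℝ} (hA : UniqueDiffOn ℝ A) {u u' : ℝ → E} (hu : ∀ t ∈ A, HasDerivWithinAt u (u' t) A t)
    (hu' : ContinuousOn u' A) : ContDiffOn ℝ 1 u A :=
  (contDiffOn_one_iff_derivWithin hA).2 ⟨fun t ht => (hu t ht).differentiableWithinAt,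
    hu'.congr fun t ht => (hu t ht).derivWithin (hA t ht)⟩

variable {T₀ : ℝ} {lam : ℕ → ℝ} {p : ℝ → ℝ} {f : ℝ → L2 Ω} {φ : L2 Ω}

/-- A curve whose generator `z = p u + f - u'` acts diagonally on the eigenfunctions is a weak
solution. -/
theorem IsResolvent.isWeakSolution (hT : IsResolvent s Ω T) (hΩ : MeasurableSet Ω)
    {b : HilbertBasis ℕ ℝ (L2 Ω)} (h : ∀ k, IsEigenpair s Ω (lam k) (b k)) {u u' z : ℝ → L2 Ω}
    (hu : ContinuousOn u (Icc 0 T₀)) (hz : ContinuousOn z (Ioc 0 T₀))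
    (hu' : ContinuousOn u' (Ioc 0 T₀))
    (hder : ∀ t ∈ Ioc 0 T₀, HasDerivWithinAt u (u' t) (Ioc 0 T₀) t)
    (hzu : ∀ t ∈ Ioc 0 T₀, ∀ k, ⟪b k, z t⟫_ℝ = lam k * ⟪b k, u t⟫_ℝ)
    (heq : ∀ t ∈ Ioc 0 T₀, u' t + z t = p t • u t + f t) (h0 : u 0 = φ) :
    IsWeakSolution s Ω T₀ p f φ u := by
  have hdom := fun t ht => hT.mem_domain hΩ h (hzu t ht)
  refine ⟨hu, ⟨fun t ht => (hdom t ht).1, fun t ht => ?_⟩,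
    contDiffOn_one_of_hasDerivWithinAt (uniqueDiffOn_Ioc 0 T₀) hder hu', fun t ht v hv => ?_, h0⟩
  · have hcont : Tendsto (fun τ => √⟪z τ - z t, u τ - u t⟫_ℝ) (𝓝[Ioc 0 T₀] t) (𝓝 0) := by
      have h1 : ContinuousWithinAt (fun τ => √⟪z τ - z t, u τ - u t⟫_ℝ) (Ioc 0 T₀) t :=
        (((hz t ht).sub continuousWithinAt_const).inner
          (((hu.mono Ioc_subset_Icc_self) t ht).sub continuousWithinAt_const)).sqrt
      simpa [ContinuousWithinAt] using h1
    refine hcont.congr' ?_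
    filter_upwards [self_mem_nhdsWithin] with τ hτ
    have h1 := hT.mem_domain hΩ h (u := u τ - u t) (z := z τ - z t) fun k => by
      rw [inner_sub_right, inner_sub_right, hzu τ hτ, hzu t ht]
      ring
    rw [normH0s, ← h1.2 _ h1.1, innerH0s_congr s (zeroExt_sub hΩ _ _) (zeroExt_sub hΩ _ _)]
  · have ht' : t ∈ Ioc 0 T₀ := Ioo_subset_Ioc_self ht
    have hd : deriv u t = u' t :=
      ((hder t ht').hasDerivAt (Ioc_mem_nhds ht.1 ht.2)).deriv
    have h1 := (hdom t ht').2 _ (hv.zeroExt_toLp hΩ)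
    rw [innerH0s_congr s EventuallyEq.rfl (hv.congr_zeroExt hΩ)] at h1
    have h2 : ∫ x in Ω, p t * (u t) x * v x = p t * ∫ x in Ω, (u t) x * v x := by
      rw [← integral_const_mul]
      simp_rw [mul_assoc]
    rw [h1, h2, hd, integral_mul_toLp _ hv.memHs.memLp, integral_mul_toLp _ hv.memHs.memLp,
      integral_mul_toLp _ hv.memHs.memLp, ← inner_add_left, heq t ht', inner_add_left,
      inner_smul_left]
    simp

/-- The coefficients of a weak solution satisfy scalar linear equations. -/
theorem IsWeakSolution.hasDerivAt_coeff (hΩ : MeasurableSet Ω) {w : L2 Ω} {μ : ℝ}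
    (hw : IsEigenpair s Ω μ w) {u : ℝ → L2 Ω} (hu : IsWeakSolution s Ω T₀ p f φ u) {t : ℝ}
    (ht : t ∈ Ioo 0 T₀) :
    HasDerivAt (fun t => ⟪w, u t⟫_ℝ) ((p t - μ) * ⟪w, u t⟫_ℝ + ⟪w, f t⟫_ℝ) t := by
  have hd : HasDerivAt u (deriv u t) t :=
    (((hu.contDiffOn.differentiableOn one_ne_zero) t (Ioo_subset_Ioc_self ht)).differentiableAt
      (Ioc_mem_nhds ht.1 ht.2)).hasDerivAt
  have h1 : HasDerivAt (fun t => ⟪w, u t⟫_ℝ) ⟪w, deriv u t⟫_ℝ t := by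
    simpa using (hasDerivAt_const t w).inner ℝ hd
  refine h1.congr_deriv ?_
  -- The equation is tested with the eigenfunction w; the form term becomes μ (w, u(t)) by symmetry
  -- and the eigenvalue equation tested with u(t).
  have h2 := hu.weak_eq t ht _ hw.memH0s
  have h3 : ∫ x in Ω, p t * (u t) x * zeroExt Ω w x = p t * ∫ x in Ω, (u t) x * zeroExt Ω w x := by
    rw [← integral_const_mul]
    simp_rw [mul_assoc]
  rw [innerH0s_comm, hw.weak_eq _ (hu.continuousInH0s.memH0s t (Ioo_subset_Ioc_self ht)), h3] at h2
  simp only [integral_mul_zeroExt hΩ] at h2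
  rw [real_inner_comm w (deriv u t), real_inner_comm w (u t), real_inner_comm w (f t)] at h2
  linarith

/-- Weak solutions are unique. -/
theorem IsWeakSolution.eqOn (hΩ : MeasurableSet Ω) {b : HilbertBasis ℕ ℝ (L2 Ω)}
    (h : ∀ k, IsEigenpair s Ω (lam k) (b k)) (hT₀ : 0 < T₀) (hp : ContinuousOn p (Icc 0 T₀))
    {u v : ℝ → L2 Ω} (hu : IsWeakSolution s Ω T₀ p f φ u) (hv : IsWeakSolution s Ω T₀ p f φ v) :
    EqOn v u (Icc 0 T₀) := by
  obtain ⟨q, hq, hqp⟩ := exists_continuous_eqOn_Icc hT₀.le hp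
  intro t ht
  refine ext_coeff b fun k => sub_eq_zero.1 ?_
  refine eqOn_zero_of_hasDerivAt_mul (q := fun t => q t - lam k)
    (d := fun t => ⟪b k, v t⟫_ℝ - ⟪b k, u t⟫_ℝ) (hq.sub continuous_const)
    ((continuousOn_const.inner hv.continuousOn).sub (continuousOn_const.inner hu.continuousOn))
    (fun τ hτ => ?_) (by rw [hu.initial, hv.initial, sub_self]) t ht
  refine ((hv.hasDerivAt_coeff hΩ (h k) hτ).sub (hu.hasDerivAt_coeff hΩ (h k) hτ)).congr_deriv ?_
  rw [hqp (Ioo_subset_Icc_self hτ)]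
  ring

/-- The series solution is a weak solution. -/
theorem IsResolvent.seriesSolution (hT : IsResolvent s Ω T) (hΩ : MeasurableSet Ω)
    {b : HilbertBasis ℕ ℝ (L2 Ω)} (h : ∀ k, IsEigenpair s Ω (lam k) (b k)) (hT₀ : 0 < T₀)
    (hf : ContinuousOn f (Icc 0 T₀)) (hf' : ContDiffOn ℝ 1 f (Ioc 0 T₀))
    (hp : ContinuousOn p (Icc 0 T₀)) :
    (∀ t ∈ Icc (0 : ℝ) T₀, Summable (fun k => homCoeff lam b p φ k t • b k) ∧
      Summable (fun k => sourceCoeff lam b p f k t • b k)) ∧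
    IsWeakSolution s Ω T₀ p f φ (seriesSolution lam b p f φ) := by
  obtain ⟨q, hq, hqp⟩ := exists_continuous_eqOn_Icc hT₀.le hp
  obtain ⟨F, hF, hFf⟩ := exists_continuous_eqOn_Icc hT₀.le hf
  have hlam : ∀ k, 0 ≤ lam k := fun k => (h k).nonneg hΩ
  set P : ℝ → ℝ := fun t => ∫ τ in (0 : ℝ)..t, q τ with hPdef
  have hPd : ∀ t, HasDerivAt P (q t) t := fun t => (hq.integral_hasStrictDerivAt 0 t).hasDerivAt
  have hP1 : ContDiff ℝ 1 P := by
    rw [contDiff_one_iff_deriv]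
    refine ⟨fun t => (hPd t).differentiableAt, ?_⟩
    rwa [show deriv P = q from funext fun t => (hPd t).deriv]
  have hPc : Continuous P := hP1.continuous
  have hint : ∀ τ t, τ ∈ Icc 0 T₀ → t ∈ Icc 0 T₀ → ∫ y in τ..t, p y = P t - P τ := by
    intro τ t hτ ht
    rw [hPdef, intervalIntegral.integral_interval_sub_left (hq.intervalIntegrable _ _)
      (hq.intervalIntegrable _ _)]
    refine intervalIntegral.integral_congr fun y hy => (hqp ?_).symm
    exact ordConnected_Icc.uIcc_subset hτ ht hy
  have h0mem : (0 : ℝ) ∈ Icc 0 T₀ := ⟨le_rfl, hT₀.le⟩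
  have hP0 : P 0 = 0 := intervalIntegral.integral_same
  -- Source of the equation for V = e^{-P} u, from which the potential has disappeared.
  set g : ℝ → L2 Ω := fun t => Real.exp (-P t) • F t with hgdef
  have hg : Continuous g := hPc.neg.rexp.smul hF
  have hg' : ContDiffOn ℝ 1 g (Ioc 0 T₀) :=
    (hP1.neg.exp.contDiffOn).smul (hf'.congr fun t ht => hFf (Ioc_subset_Icc_self ht))
  obtain ⟨V, y, hV, hy, hVy, hVk, hyk⟩ := exists_classical_solution b hlam φ hg hg'
  set U : ℝ → L2 Ω := fun t => Real.exp (P t) • V t with hUdef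
  have hUk : ∀ t ∈ Icc 0 T₀, ∀ k,
      ⟪b k, U t⟫_ℝ = homCoeff lam b p φ k t + sourceCoeff lam b p f k t := by
    intro t ht k
    rw [hUdef, inner_smul_right, hVk t ht, mul_add, homCoeff, sourceCoeff, hint 0 t h0mem ht, hP0,
      sub_zero, Real.exp_add, real_inner_comm φ (b k)]
    congr 1
    · ring
    · rw [← intervalIntegral.integral_const_mul]
      refine intervalIntegral.integral_congr fun τ hτ => ?_
      rw [uIcc_of_le ht.1] at hτ
      have hτ' : τ ∈ Icc 0 T₀ := ⟨hτ.1, hτ.2.trans ht.2⟩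
      simp only [hgdef]
      rw [hint τ t hτ' ht, hFf hτ', inner_smul_right, Real.exp_add, Real.exp_sub, Real.exp_neg,
        real_inner_comm (f τ) (b k)]
      field_simp
  have hsplit : ∀ t ∈ Icc 0 T₀, HasSum (fun k => homCoeff lam b p φ k t • b k)
      (∑' k, homCoeff lam b p φ k t • b k) ∧ HasSum (fun k => sourceCoeff lam b p f k t • b k)
      (∑' k, sourceCoeff lam b p f k t • b k) ∧ FracHeat.seriesSolution lam b p f φ t = U t := by
    intro t ht
    -- Only the homogeneous series needs a majorant, e^{P(t)} φ. The source series then converges to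
    -- U(t) - x, whose coefficients are known.
    obtain ⟨x, hx⟩ := exists_coeff (c := fun k => homCoeff lam b p φ k t)
      (B := Real.exp (P t) • φ) b fun k => by
        rw [homCoeff, hint 0 t h0mem ht, hP0, sub_zero, Real.exp_add, real_inner_comm (b k) φ,
          inner_smul_right, abs_mul, abs_mul, abs_mul, Real.abs_exp, Real.abs_exp]
        have : Real.exp (-lam k * t) ≤ 1 :=
          Real.exp_le_one_iff.2 (by nlinarith [hlam k, ht.1])
        nlinarith [mul_nonneg (abs_nonneg ⟪b k, φ⟫_ℝ) (Real.exp_pos (P t)).le]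
    have hx1 : HasSum (fun k => homCoeff lam b p φ k t • b k) x :=
      (b.hasSum_repr x).congr_fun fun k => by rw [b.repr_apply_apply, hx]
    have hx2 : HasSum (fun k => sourceCoeff lam b p f k t • b k) (U t - x) :=
      (b.hasSum_repr (U t - x)).congr_fun fun k => by
        rw [b.repr_apply_apply, inner_sub_right, hx, hUk t ht, add_sub_cancel_left]
    refine ⟨hx1.summable.hasSum, hx2.summable.hasSum, ?_⟩
    rw [FracHeat.seriesSolution, hx1.tsum_eq, hx2.tsum_eq, add_sub_cancel]
  have hUeq : EqOn (FracHeat.seriesSolution lam b p f φ) U (Icc 0 T₀) :=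
    fun t ht => (hsplit t ht).2.2
  refine ⟨fun t ht => ⟨(hsplit t ht).1.summable, (hsplit t ht).2.1.summable⟩, ?_⟩
  have hVIoc : ContinuousOn V (Ioc 0 T₀) := hV.mono Ioc_subset_Icc_self
  have hE : Continuous fun t => Real.exp (P t) := hPc.rexp
  -- The derivative is the product rule for e^P V with V' = y, and z is AU = e^P AV = e^P (g - y).
  refine hT.isWeakSolution hΩ h
    (u' := fun t => Real.exp (P t) • y t + (Real.exp (P t) * q t) • V t)
    (z := fun t => Real.exp (P t) • (g t - y t)) ?_ ?_ ?_ ?_ ?_ ?_ ?_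
  · exact (hE.continuousOn.smul hV).congr hUeq
  · exact hE.continuousOn.smul (hg.continuousOn.sub hy)
  · exact (hE.continuousOn.smul hy).add ((hE.mul hq).continuousOn.smul hVIoc)
  · intro t ht
    refine HasDerivWithinAt.congr ?_ (fun τ hτ => hUeq (Ioc_subset_Icc_self hτ))
      (hUeq (Ioc_subset_Icc_self ht))
    exact (hPd t).exp.hasDerivWithinAt.smul (hVy t ht)
  · intro t ht k
    rw [hUeq (Ioc_subset_Icc_self ht), hUdef, inner_smul_right, inner_smul_right, inner_sub_right,
      hyk t ht]
    ring
  · intro t ht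
    rw [hUeq (Ioc_subset_Icc_self ht), ← hqp (Ioc_subset_Icc_self ht),
      ← hFf (Ioc_subset_Icc_self ht)]
    have h1 : Real.exp (P t) • g t = F t := by
      rw [hgdef, smul_smul, ← Real.exp_add, add_neg_cancel, Real.exp_zero, one_smul]
    rw [← h1, show U t = Real.exp (P t) • V t from rfl, mul_smul, smul_sub, smul_comm (q t)]
    abel
  · rw [hUeq h0mem]
    refine ext_coeff b fun k => ?_
    rw [hUk 0 h0mem, homCoeff, sourceCoeff, hint 0 0 h0mem h0mem, intervalIntegral.integral_same]
    simp [real_inner_comm]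

end Main

end FracHeat

end

theorem mainTheorem5 (n : ℕ) (hn : 0 < n) (s : ℝ) (hs : s ∈ Set.Ioo (0 : ℝ) 1)
    (Ω : Set (FracHeat.Space n)) (hΩ_open : IsOpen Ω) (hΩ_bdd : Bornology.IsBounded Ω)
    (hΩ_ne : Ω.Nonempty) (T : ℝ) (hT : 0 < T)
    (φ : FracHeat.L2 Ω) (f : ℝ → FracHeat.L2 Ω) (hf : ContinuousOn f (Icc 0 T))
    (hf' : ContDiffOn ℝ 1 f (Ioc 0 T)) (p : ℝ → ℝ) (hp : ContinuousOn p (Icc 0 T)) :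
    (∃ (lam : ℕ → ℝ) (e : ℕ → FracHeat.L2 Ω), FracHeat.IsEigensystem s Ω lam e) ∧
    ∀ (lam : ℕ → ℝ) (e : ℕ → FracHeat.L2 Ω), FracHeat.IsEigensystem s Ω lam e →
      (∀ t ∈ Icc (0 : ℝ) T,
        Summable (fun k => FracHeat.homCoeff lam e p φ k t • e k) ∧
        Summable (fun k => FracHeat.sourceCoeff lam e p f k t • e k)) ∧
      FracHeat.IsWeakSolution s Ω T p f φ (FracHeat.seriesSolution lam e p f φ) ∧
      ∀ v : ℝ → FracHeat.L2 Ω, FracHeat.IsWeakSolution s Ω T p f φ v →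
        EqOn v (FracHeat.seriesSolution lam e p f φ) (Icc 0 T) := by
  have hm := hΩ_open.measurableSet
  obtain ⟨R, hR⟩ := FracHeat.exists_isResolvent hn hs hΩ_open hΩ_bdd
  refine ⟨hR.exists_isEigensystem hm (FracHeat.not_finiteDimensional_L2 hn hΩ_open hΩ_ne hΩ_bdd),
    fun lam e he => ?_⟩
  obtain ⟨b, hb⟩ := he.exists_hilbertBasis hR hm
  obtain rfl : e = b := funext fun k => (hb k).symm
  obtain ⟨h1, h2⟩ := hR.seriesSolution (φ := φ) hm he.eigenpair hT hf hf' hp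
  exact ⟨h1, h2, fun v hv => h2.eqOn hm he.eigenpair hT hp hv⟩
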